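/- Let $S$ and $M$ be smooth Riemannian manifolds, let $r=\dim S\ge 2$, and let $f:S\to M$ be a smooth isometric immersion. For $p\in S$ regard $T_pS$ as a subspace of $T_{f(p)}M$ by means of $df_p$, and let $Z\mapsto Z^\perp$ denote the orthogonal projection of $T_{f(p)}M$ onto the orthogonal complement $(T_pS)^\perp$. Let $\bar\nabla$ be the Levi-Civita connection of $M$ (and the induced connection on vector fields along $f$) and $\bar R(X,Y)=\bar\nabla_X\bar\nabla_Y-\bar\nabla_Y\bar\nabla_X-\bar\nabla_{[X,Y]}$ its curvature tensor. Let $\nabla^\perp_X\eta=(\bar\nabla_X\eta)^\perp$ be the normal connection, $\alpha(X,Y)=(\bar\nabla_XY)^\perp$ (for vector fields $X,Y$ on $S$) the second fundamental form, and $H=\frac1r\sum_{i=1}^r\alpha(e_i,e_i)$, with $(e_i)$ an orthonormal basis of $T_pS$, the mean curvature vector of $f$. Assume that $f$ is umbilical, that is, $\alpha(X,Y)=\langle X,Y\rangle H$ for all $X,Y$. Then the following three conditions are equivalent: 1. $f$ is special: for every $p\in S$, every orthonormal basis $v_1,\dots,v_r$ of $T_pS$ and every $w\in T_pS$, $\sum_{i=1}^r\bar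 R(v_i,w)v_i\in T_pS$; 2. $f$ is very special: for every $p\in S$ and all $v,w\in T_pS$, $\bar R(v,w)v\in T_pS$; 3. $f$ is an extrinsic sphere: $f$ is umbilical and its mean curvature vector is parallel, that is, $\nabla^\perp_vH=0$ for every $p\in S$ and every $v\in T_pS$. -/

import Mathlib

open Bundle VectorField FiberBundle
open scoped Manifold ContDiff

noncomputable section

namespace SubmanifoldGeometry

section LeviCivita

variable {E : Type*} [NormedAddCommGroup E] [NormedSpace ℝ E] [FiniteDimensional ℝ E]
  {H : Type*} [TopologicalSpace H] {I : ModelWithCorners ℝ E H}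
  {M : Type*} [TopologicalSpace M] [ChartedSpace H M] [IsManifold I ∞ M]
  [RiemannianBundle (fun x : M ↦ TangentSpace I x)]
  [IsContMDiffRiemannianBundle I ∞ E (fun x : M ↦ TangentSpace I x)]

instance finiteDimensionalTangentSpace (x : M) : FiniteDimensional ℝ (TangentSpace I x) :=
  inferInstanceAs (FiniteDimensional ℝ E)

/-- The right-hand side of the Koszul formula for `⟨∇_X Y, Z⟩`, namely
`(X⟨Y, Z⟩ + Y⟨Z, X⟩ - Z⟨X, Y⟩ + ⟨[X, Y], Z⟩ - ⟨[X, Z], Y⟩ - ⟨[Y, Z], X⟩) / 2`. -/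
def koszul (X Y Z : Π x : M, TangentSpace I x) (x : M) : ℝ :=
  (1 / 2) * (mvfderiv I (fun y ↦ inner ℝ (Y y) (Z y)) x (X x)
    + mvfderiv I (fun y ↦ inner ℝ (Z y) (X y)) x (Y x)
    - mvfderiv I (fun y ↦ inner ℝ (X y) (Y y)) x (Z x)
    + inner ℝ (mlieBracket I X Y x) (Z x)
    - inner ℝ (mlieBracket I X Z x) (Y x)
    - inner ℝ (mlieBracket I Y Z x) (X x))

theorem mdifferentiableAt_inner {X Y : Π x : M, TangentSpace I x} {x : M}
    (hX : MDiffAt (T% X) x) (hY : MDiffAt (T% Y) x) :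
    MDiffAt (fun y ↦ inner ℝ (X y) (Y y)) x :=
  MDifferentiableAt.inner_bundle (IB := I) (E := fun y : M ↦ TangentSpace I y) (b := id)
    (v := X) (w := Y) hX hY

theorem koszul_tensorial_right {X Y : Π x : M, TangentSpace I x} {x : M}
    (hX : MDiffAt (T% X) x) (hY : MDiffAt (T% Y) x) :
    TensorialAt I E (fun Z ↦ koszul X Y Z x) x := by
  have := FiniteDimensional.complete ℝ E
  constructor
  · intro f Z hf hZ
    have h1 := mvfderiv_fun_mul hf (mdifferentiableAt_inner hY hZ)
    have h2 := mvfderiv_fun_mul hf (mdifferentiableAt_inner hZ hX)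
    simp [koszul, inner_smul_left, inner_smul_right, h1, h2, mlieBracket_smul_right hf hZ,
      inner_add_left]
    rw [real_inner_comm (Z x) (Y x)]
    ring
  · intro Z Z' hZ hZ'
    have h1 := mvfderiv_fun_add (mdifferentiableAt_inner hY hZ) (mdifferentiableAt_inner hY hZ')
    have h2 := mvfderiv_fun_add (mdifferentiableAt_inner hZ hX) (mdifferentiableAt_inner hZ' hX)
    simp [koszul, inner_add_left, inner_add_right, h1, h2, mlieBracket_add_right hZ hZ']
    ring

theorem koszul_tensorial_left {Y Z : Π x : M, TangentSpace I x} {x : M}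
    (hY : MDiffAt (T% Y) x) (hZ : MDiffAt (T% Z) x) :
    TensorialAt I E (fun X ↦ koszul X Y Z x) x := by
  have := FiniteDimensional.complete ℝ E
  constructor
  · intro f X hf hX
    have h1 := mvfderiv_fun_mul hf (mdifferentiableAt_inner hX hY)
    have h2 := mvfderiv_fun_mul hf (mdifferentiableAt_inner hZ hX)
    simp [koszul, inner_smul_left, inner_smul_right, h1, h2, mlieBracket_smul_left hf hX,
      inner_add_left]
    rw [real_inner_comm (Z x) (X x)]
    ring
  · intro X X' hX hX'
    have h1 := mvfderiv_fun_add (mdifferentiableAt_inner hX hY) (mdifferentiableAt_inner hX' hY)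
    have h2 := mvfderiv_fun_add (mdifferentiableAt_inner hZ hX) (mdifferentiableAt_inner hZ hX')
    simp [koszul, inner_add_left, inner_add_right, h1, h2, mlieBracket_add_left hX hX']
    ring

/-- The bilinear form `(u, w) ↦ ⟨∇_u Y, w⟩` on `T_x M` given by the Koszul formula. -/
def koszulForm (Y : Π x : M, TangentSpace I x) (x : M) (hY : MDiffAt (T% Y) x) :
    TangentSpace I x →L[ℝ] TangentSpace I x →L[ℝ] ℝ :=
  TensorialAt.mkHom₂ (fun X Z ↦ koszul X Y Z x) x
    (fun _ hZ ↦ koszul_tensorial_left hY hZ) (fun _ hX ↦ koszul_tensorial_right hX hY)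

theorem koszulForm_apply {X Y Z : Π x : M, TangentSpace I x} {x : M}
    (hX : MDiffAt (T% X) x) (hY : MDiffAt (T% Y) x) (hZ : MDiffAt (T% Z) x) :
    koszulForm Y x hY (X x) (Z x) = koszul X Y Z x :=
  TensorialAt.mkHom₂_apply _ _ hX hZ

open scoped Classical in
/-- The endomorphism `u ↦ ∇_u Y` of `T_x M`, for a vector field `Y` differentiable at `x`. -/
def leviCivitaFun (Y : Π x : M, TangentSpace I x) (x : M) :
    TangentSpace I x →L[ℝ] TangentSpace I x :=
  haveI := FiniteDimensional.complete ℝ (TangentSpace I x)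
  if hY : MDiffAt (T% Y) x then
    ((InnerProductSpace.toDual ℝ (TangentSpace I x)).symm : (TangentSpace I x →L[ℝ] ℝ) →L⋆[ℝ] TangentSpace I x) ∘L (koszulForm Y x hY)
  else 0

theorem inner_leviCivitaFun {X Y Z : Π x : M, TangentSpace I x} {x : M}
    (hX : MDiffAt (T% X) x) (hY : MDiffAt (T% Y) x) (hZ : MDiffAt (T% Z) x) :
    inner ℝ (leviCivitaFun Y x (X x)) (Z x) = koszul X Y Z x := by
  simp [leviCivitaFun, hY, ← koszulForm_apply hX hY hZ]


theorem ext_inner_extend {x : M} {A B : TangentSpace I x →L[ℝ] TangentSpace I x}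
    (h : ∀ X Z : Π x : M, TangentSpace I x, MDiffAt (T% X) x → MDiffAt (T% Z) x →
      inner ℝ (A (X x)) (Z x) = inner ℝ (B (X x)) (Z x)) : A = B := by
  ext u
  refine ext_inner_right ℝ fun w ↦ ?_
  simpa using h (extend E u) (extend E w) (mdifferentiableAt_extend I E u)
    (mdifferentiableAt_extend I E w)

variable (I M) in
/-- The Levi-Civita connection of `M`, constructed from the Koszul formula. It is shown below to be
compatible with the metric and torsion-free. `leviCivita I M Y x u` is `∇_u Y` at `x`. -/
def leviCivita : CovariantDerivative I E (TangentSpace I : M → Type _) where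
  toFun := leviCivitaFun
  isCovariantDerivativeOnUniv := by
    have := FiniteDimensional.complete ℝ E
    constructor
    · intro σ σ' x hσ hσ' _
      refine ext_inner_extend fun X Z hX hZ ↦ ?_
      have h1 := mvfderiv_fun_add (mdifferentiableAt_inner hσ hZ) (mdifferentiableAt_inner hσ' hZ)
      have h2 := mvfderiv_fun_add (mdifferentiableAt_inner hX hσ) (mdifferentiableAt_inner hX hσ')
      rw [_root_.add_apply, inner_add_left, inner_leviCivitaFun hX hσ hZ,
        inner_leviCivitaFun hX hσ' hZ,
        inner_leviCivitaFun hX (mdifferentiableAt_add_section hσ hσ') hZ]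
      simp [koszul, inner_add_left, inner_add_right, h1, h2, mlieBracket_add_right hσ hσ',
        mlieBracket_add_left hσ hσ']
      ring
    · intro σ f x hσ hf _
      refine ext_inner_extend fun X Z hX hZ ↦ ?_
      have h1 := mvfderiv_fun_mul hf (mdifferentiableAt_inner hσ hZ)
      have h2 := mvfderiv_fun_mul hf (mdifferentiableAt_inner hX hσ)
      have h3 := inner_leviCivitaFun hX hσ hZ
      have h4 := inner_leviCivitaFun hX (hf.smul_section hσ) hZ
      simp only [_root_.add_apply, _root_.smul_apply,
        ContinuousLinearMap.smulRight_apply, inner_add_left, real_inner_smul_left] at h3 h4 ⊢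
      rw [h3]
      refine h4.trans ?_
      simp [koszul, inner_smul_left, inner_smul_right, h1, h2, mlieBracket_smul_left hf hσ,
        mlieBracket_smul_right hf hσ, inner_add_left]
      rw [real_inner_comm (X x) (σ x)]
      ring

theorem leviCivita_apply (Y : Π x : M, TangentSpace I x) (x : M) :
    leviCivita I M Y x = leviCivitaFun Y x := rfl

theorem leviCivita_isMetricCompatible :
    CovariantDerivative.IsMetricCompatible (F := E) (V := fun x : M ↦ TangentSpace I x)
      (leviCivita I M) := by
  rw [CovariantDerivative.isMetricCompatible_iff]
  intro x X σ τ hX hσ hτ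
  have h1 : inner ℝ (leviCivita I M σ x (X x)) (τ x) = koszul X σ τ x :=
    inner_leviCivitaFun hX hσ hτ
  have h2 : inner ℝ (leviCivita I M τ x (X x)) (σ x) = koszul X τ σ x :=
    inner_leviCivitaFun hX hτ hσ
  simp only [h1, real_inner_comm (leviCivita I M τ x (X x)) (σ x), h2, koszul]
  have e (Y Z : Π x : M, TangentSpace I x) :
      (fun y ↦ inner ℝ (Y y) (Z y)) = (fun y ↦ inner ℝ (Z y) (Y y)) :=
    funext fun y ↦ real_inner_comm _ _
  rw [mlieBracket_swap_apply (V := τ) (W := σ), e τ σ, e X τ, e σ X, inner_neg_left]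
  ring

theorem leviCivita_torsion_eq_zero :
    have := FiniteDimensional.complete ℝ E
    (leviCivita I M).torsion = 0 := by
  have := FiniteDimensional.complete ℝ E
  refine (leviCivita I M).torsion_eq_zero_iff.2 fun {X Y x} hX hY ↦ ?_
  refine ext_inner_right ℝ fun w ↦ ?_
  have hZ := mdifferentiableAt_extend I E w
  have h1 : inner ℝ (leviCivita I M Y x (X x)) w = koszul X Y (extend E w) x := by
    simpa [leviCivita_apply] using inner_leviCivitaFun hX hY hZ
  have h2 : inner ℝ (leviCivita I M X x (Y x)) w = koszul Y X (extend E w) x := by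
    simpa [leviCivita_apply] using inner_leviCivitaFun hY hX hZ
  rw [inner_sub_left, h1, h2]
  have e (Y Z : Π x : M, TangentSpace I x) :
      (fun y ↦ inner ℝ (Y y) (Z y)) = (fun y ↦ inner ℝ (Z y) (Y y)) :=
    funext fun y ↦ real_inner_comm _ _
  simp only [koszul, extend_apply_self]
  rw [mlieBracket_swap_apply (V := Y) (W := X), e Y X, e (extend E w) X, e (extend E w) Y,
    inner_neg_left]
  ring

end LeviCivita

section Curvature

variable {E : Type*} [NormedAddCommGroup E] [NormedSpace ℝ E] [FiniteDimensional ℝ E]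
  {H : Type*} [TopologicalSpace H] (I : ModelWithCorners ℝ E H)
  {M : Type*} [TopologicalSpace M] [ChartedSpace H M] [IsManifold I ∞ M]
  [RiemannianBundle (fun x : M ↦ TangentSpace I x)]
  [IsContMDiffRiemannianBundle I ∞ E (fun x : M ↦ TangentSpace I x)]

/-- The curvature tensor `R(u, v) w` of the Levi-Civita connection at `x`, with the sign convention
`R(X, Y) Z = ∇_X ∇_Y Z - ∇_Y ∇_X Z - ∇_[X, Y] Z`. The tangent vectors `u`, `v`, `w` are extended
to vector fields `X`, `Y`, `Z` which are smooth near `x`. -/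
def curvature (x : M) (u v w : TangentSpace I x) : TangentSpace I x :=
  let X : Π y : M, TangentSpace I y := extend E u
  let Y : Π y : M, TangentSpace I y := extend E v
  let Z : Π y : M, TangentSpace I y := extend E w
  leviCivita I M (fun y ↦ leviCivita I M Z y (Y y)) x u
    - leviCivita I M (fun y ↦ leviCivita I M Z y (X y)) x v
    - leviCivita I M Z x (mlieBracket I X Y x)

end Curvature

section Immersions

variable {E : Type*} [NormedAddCommGroup E] [NormedSpace ℝ E] [FiniteDimensional ℝ E]
  {H : Type*} [TopologicalSpace H] (I : ModelWithCorners ℝ E H)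
  {S : Type*} [TopologicalSpace S] [ChartedSpace H S] [IsManifold I ∞ S]
  [RiemannianBundle (fun p : S ↦ TangentSpace I p)]
  {E' : Type*} [NormedAddCommGroup E'] [NormedSpace ℝ E'] [FiniteDimensional ℝ E']
  {H' : Type*} [TopologicalSpace H'] (J : ModelWithCorners ℝ E' H')
  {M : Type*} [TopologicalSpace M] [ChartedSpace H' M] [IsManifold J ∞ M]
  [RiemannianBundle (fun x : M ↦ TangentSpace J x)]

/-- A smooth map whose differential preserves the Riemannian metrics
(in particular, the differential is injective at each point). -/
structure IsIsometricImmersion (f : S → M) : Prop where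
  contMDiff : ContMDiff I J ∞ f
  inner_mfderiv (p : S) (u v : TangentSpace I p) :
    inner ℝ (mfderiv I J f p u) (mfderiv I J f p v) = inner ℝ u v

/-- The tangent space `T_p S`, seen as a subspace of `T_{f p} M`. -/
def tangentSubspace (f : S → M) (p : S) : Submodule ℝ (TangentSpace J (f p)) :=
  (mfderiv I J f p).range

/-- The orthogonal projection `Z ↦ Z^⊥` of `T_{f p} M` onto the normal space `(T_p S)^⊥`. -/
def normalPart (f : S → M) (p : S) (z : TangentSpace J (f p)) : TangentSpace J (f p) :=
  (tangentSubspace I J f p)ᗮ.starProjection z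

section

variable [IsContMDiffRiemannianBundle J ∞ E' (fun x : M ↦ TangentSpace J x)]

/-- The covariant derivative of the vector field `η` along `f` in the direction `v`, for the
connection on `f^* TM` induced by the Levi-Civita connection of `M`: in the frame `(e_i)` of `TM`
near `f p` given by the preferred chart at `f p`, if `η = ∑ η^i e_i ∘ f` then
`∇_v η = ∑ (dη^i(v) e_i + η^i(p) ∇_{df v} e_i)`. The second sum is the derivative of
`extend E' (η p) = ∑ η^i(p) e_i`. -/
def covariantDerivativeAlong (f : S → M) (η : Π q : S, TangentSpace J (f q)) (p : S)
    (v : TangentSpace I p) : TangentSpace J (f p) :=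
  let t := trivializationAt E' (TangentSpace J : M → Type _) (f p)
  t.symmL ℝ (f p) (mvfderiv I (fun q ↦ (t ⟨f q, η q⟩).2) p v)
    + leviCivita J M (extend E' (η p)) (f p) (mfderiv I J f p v)

/-- The normal connection `∇^⊥_v η = (∇_v η)^⊥`. -/
def normalDerivative (f : S → M) (η : Π q : S, TangentSpace J (f q)) (p : S)
    (v : TangentSpace I p) : TangentSpace J (f p) :=
  normalPart I J f p (covariantDerivativeAlong I J f η p v)

/-- The second fundamental form `α(u, v) = (∇_u V)^⊥`, where `V` is a tangent vector field on `S`,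
smooth near `p`, with `V p = v`. -/
def secondFundamentalForm (f : S → M) (p : S) (u v : TangentSpace I p) : TangentSpace J (f p) :=
  normalPart I J f p
    (covariantDerivativeAlong I J f (fun q ↦ mfderiv I J f q (extend E v q)) p u)

/-- The mean curvature vector `H = (1/r) ∑ α(e_i, e_i)`, where `(e_i)` is an orthonormal basis of
`T_p S` and `r` is the dimension of `S`. -/
def meanCurvatureVector (f : S → M) (p : S) : TangentSpace J (f p) :=
  (Module.finrank ℝ (TangentSpace I p) : ℝ)⁻¹ • ∑ i,
    secondFundamentalForm I J f p (stdOrthonormalBasis ℝ (TangentSpace I p) i)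
      (stdOrthonormalBasis ℝ (TangentSpace I p) i)

/-- `f` is umbilical: `α(u, v) = ⟨u, v⟩ H`. -/
def IsUmbilical (f : S → M) : Prop :=
  ∀ (p : S) (u v : TangentSpace I p),
    secondFundamentalForm I J f p u v = inner ℝ u v • meanCurvatureVector I J f p

/-- The mean curvature vector is parallel: `∇^⊥ H = 0`. -/
def HasParallelMeanCurvature (f : S → M) : Prop :=
  ∀ (p : S) (v : TangentSpace I p), normalDerivative I J f (meanCurvatureVector I J f) p v = 0

/-- An extrinsic sphere is an umbilical immersion with parallel mean curvature vector. -/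
def IsExtrinsicSphere (f : S → M) : Prop :=
  IsUmbilical I J f ∧ HasParallelMeanCurvature I J f

/-- `f` is special: `∑ R(v_i, w) v_i ∈ T_p S` for each orthonormal basis `(v_i)` of `T_p S` and each
`w ∈ T_p S`, where `R` is the curvature tensor of `M`. -/
def IsSpecial (f : S → M) : Prop :=
  ∀ (p : S) (b : OrthonormalBasis (Fin (Module.finrank ℝ (TangentSpace I p))) ℝ (TangentSpace I p))
    (w : TangentSpace I p),
    ∑ i, curvature J (f p) (mfderiv I J f p (b i)) (mfderiv I J f p w) (mfderiv I J f p (b i))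
      ∈ tangentSubspace I J f p

/-- `f` is very special: `R(v, w) v ∈ T_p S` for all `v, w ∈ T_p S`, where `R` is the curvature
tensor of `M`. -/
def IsVerySpecial (f : S → M) : Prop :=
  ∀ (p : S) (v w : TangentSpace I p),
    curvature J (f p) (mfderiv I J f p v) (mfderiv I J f p w) (mfderiv I J f p v)
      ∈ tangentSubspace I J f p

end

end Immersions

end SubmanifoldGeometry

end

noncomputable section

set_option maxSynthPendingDepth 3

namespace SubmanifoldGeometry

section Coordinates

variable {E : Type*} [NormedAddCommGroup E] [NormedSpace ℝ E]
  {F : Type*} [NormedAddCommGroup F] [NormedSpace ℝ F]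

/-- A smooth Riemannian metric on a subset of a vector space. -/
structure IsMetricOn (g : E → E →L[ℝ] E →L[ℝ] ℝ) (s : Set E) : Prop where
  contDiffOn : ContDiffOn ℝ ∞ g s
  symm {y : E} (hy : y ∈ s) (a b : E) : g y a b = g y b a
  pos {y : E} (hy : y ∈ s) {a : E} (ha : a ≠ 0) : 0 < g y a a

/-- The Christoffel symbols of the first kind, as a trilinear form: `⟨∇_a b, c⟩` for constant vector
fields `a`, `b`, `c`. -/
def christoffelLower (g : E → E →L[ℝ] E →L[ℝ] ℝ) (y : E) : E →L[ℝ] E →L[ℝ] E →L[ℝ] ℝ :=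
  (1 / 2 : ℝ) • (fderiv ℝ g y + (fderiv ℝ g y).flip
    - (ContinuousLinearMap.flipₗᵢ ℝ E E ℝ : (E →L[ℝ] E →L[ℝ] ℝ) →L[ℝ] (E →L[ℝ] E →L[ℝ] ℝ)) ∘L
      (fderiv ℝ g y).flip)

theorem christoffelLower_apply (g : E → E →L[ℝ] E →L[ℝ] ℝ) (y a b c : E) :
    christoffelLower g y a b c
      = (1 / 2) * (fderiv ℝ g y a b c + fderiv ℝ g y b a c - fderiv ℝ g y c a b) := by
  simp [christoffelLower]

/-- The Christoffel symbols `∇_a b` of a metric, for constant vector fields `a`, `b`. -/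
def christoffel (g : E → E →L[ℝ] E →L[ℝ] ℝ) (y : E) : E →L[ℝ] E →L[ℝ] E :=
  ContinuousLinearMap.compL ℝ E (E →L[ℝ] ℝ) E (g y).inverse ∘L christoffelLower g y

theorem christoffel_apply (g : E → E →L[ℝ] E →L[ℝ] ℝ) (y a b : E) :
    christoffel g y a b = (g y).inverse (christoffelLower g y a b) := rfl

/-- The curvature tensor `R(a, b) c` computed from the Christoffel symbols. -/
def coordCurvature (Γ : F → F →L[ℝ] F →L[ℝ] F) (y a b c : F) : F :=
  fderiv ℝ Γ y a b c - fderiv ℝ Γ y b a c + Γ y a (Γ y b c) - Γ y b (Γ y a c)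

/-- The coordinate expression of `∇_u (df v)` for constant vector fields `u`, `v`. -/
def coordHessian (Γ : F → F →L[ℝ] F →L[ℝ] F) (f : E → F) (z u v : E) : F :=
  fderiv ℝ (fderiv ℝ f) z u v + Γ (f z) (fderiv ℝ f z u) (fderiv ℝ f z v)

namespace IsMetricOn

variable [FiniteDimensional ℝ E] {g : E → E →L[ℝ] E →L[ℝ] ℝ} {s : Set E} {y : E}

omit [FiniteDimensional ℝ E] in
theorem mono {t : Set E} (hg : IsMetricOn g s) (hts : t ⊆ s) : IsMetricOn g t where
  contDiffOn := hg.contDiffOn.mono hts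
  symm hy := hg.symm (hts hy)
  pos hy := hg.pos (hts hy)

theorem exists_equiv (hg : IsMetricOn g s) (hy : y ∈ s) :
    ∃ e : E ≃L[ℝ] (E →L[ℝ] ℝ), (e : E →L[ℝ] (E →L[ℝ] ℝ)) = g y := by
  have hinj : Function.Injective (g y : E →ₗ[ℝ] (E →L[ℝ] ℝ)) := by
    rw [injective_iff_map_eq_zero]
    intro a ha
    by_contra h
    have := hg.pos hy h
    have h2 : g y a = 0 := ha
    simp [h2] at this
  have hdim : Module.finrank ℝ E = Module.finrank ℝ (E →L[ℝ] ℝ) := by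
    rw [← (LinearMap.toContinuousLinearMap : (E →ₗ[ℝ] ℝ) ≃ₗ[ℝ] (E →L[ℝ] ℝ)).finrank_eq]
    exact (Subspace.dual_finrank_eq (K := ℝ) (V := E)).symm
  refine ⟨(LinearMap.linearEquivOfInjective _ hinj hdim).toContinuousLinearEquiv, ?_⟩
  ext a b
  rfl

theorem eq_of_forall (hg : IsMetricOn g s) (hy : y ∈ s) {a b : E} (h : ∀ c, g y a c = g y b c) :
    a = b := by
  by_contra hab
  have := hg.pos hy (sub_ne_zero.2 hab)
  simp [h] at this

theorem apply_christoffel (hg : IsMetricOn g s) (hy : y ∈ s) (a b c : E) :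
    g y (christoffel g y a b) c
      = (1 / 2) * (fderiv ℝ g y a b c + fderiv ℝ g y b a c - fderiv ℝ g y c a b) := by
  obtain ⟨e, he⟩ := hg.exists_equiv hy
  rw [christoffel_apply, ← he, ContinuousLinearMap.inverse_equiv, ← christoffelLower_apply]
  simp

theorem differentiableAt (hg : IsMetricOn g s) (hs : IsOpen s) (hy : y ∈ s) :
    DifferentiableAt ℝ g y :=
  ((hg.contDiffOn y hy).contDiffAt (hs.mem_nhds hy)).differentiableAt (by simp)

theorem fderiv_symm (hg : IsMetricOn g s) (hs : IsOpen s) (hy : y ∈ s) (w a b : E) :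
    fderiv ℝ g y w a b = fderiv ℝ g y w b a := by
  have hd := (hg.differentiableAt hs hy).hasFDerivAt
  have h1 := (hd.clm_apply (hasFDerivAt_const a y)).clm_apply (hasFDerivAt_const b y)
  have h2 := (hd.clm_apply (hasFDerivAt_const b y)).clm_apply (hasFDerivAt_const a y)
  have h3 := h2.congr_of_eventuallyEq (Filter.eventually_of_mem (hs.mem_nhds hy)
    fun x hx ↦ hg.symm hx a b)
  simpa using congr($(h1.unique h3) w)

theorem christoffel_symm (hg : IsMetricOn g s) (hs : IsOpen s) (hy : y ∈ s) (a b : E) :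
    christoffel g y a b = christoffel g y b a := by
  refine hg.eq_of_forall hy fun c ↦ ?_
  rw [hg.apply_christoffel hy, hg.apply_christoffel hy, hg.fderiv_symm hs hy c a b]
  ring

theorem fderiv_eq (hg : IsMetricOn g s) (hs : IsOpen s) (hy : y ∈ s) (w a b : E) :
    fderiv ℝ g y w a b = g y (christoffel g y w a) b + g y a (christoffel g y w b) := by
  rw [hg.symm hy a, hg.apply_christoffel hy, hg.apply_christoffel hy,
    hg.fderiv_symm hs hy w b a, hg.fderiv_symm hs hy b w a, hg.fderiv_symm hs hy a w b]
  ring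

theorem contDiffOn_christoffel (hg : IsMetricOn g s) (hs : IsOpen s) :
    ContDiffOn ℝ ∞ (christoffel g) s := by
  have : CompleteSpace E := FiniteDimensional.complete ℝ E
  intro y hy
  refine ContDiffAt.contDiffWithinAt ?_
  have hgy := (hg.contDiffOn y hy).contDiffAt (hs.mem_nhds hy)
  obtain ⟨e, he⟩ := hg.exists_equiv hy
  have hinv : ContDiffAt ℝ ∞ (fun y ↦ (g y).inverse) y := by
    refine ContDiffAt.comp (g := ContinuousLinearMap.inverse) y ?_ hgy
    rw [← he]
    exact contDiffAt_map_inverse e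
  have hD : ContDiffAt ℝ ∞ (fderiv ℝ g) y := hgy.fderiv_right (by simp)
  have hflip : ContDiffAt ℝ ∞ (fun y ↦ (fderiv ℝ g y).flip) y :=
    (ContinuousLinearMap.flipₗᵢ ℝ E E (E →L[ℝ] ℝ)).contDiff.contDiffAt.comp y hD
  refine ContDiffAt.clm_comp ?_ ?_
  · exact (ContinuousLinearMap.compL ℝ E (E →L[ℝ] ℝ) E).contDiff.contDiffAt.comp y hinv
  · exact ((hD.add hflip).sub (contDiffAt_const.clm_comp hflip)).const_smul (1 / 2 : ℝ)

end IsMetricOn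

section Immersion

variable [FiniteDimensional ℝ E] [FiniteDimensional ℝ F]
  {G : E → E →L[ℝ] E →L[ℝ] ℝ} {s : Set E} {g : F → F →L[ℝ] F →L[ℝ] ℝ} {t : Set F} {f : E → F}
  {z : E}

theorem coordHessian_symm (hg : IsMetricOn g t) (ht : IsOpen t) (hfz : f z ∈ t)
    (hf : ContDiffAt ℝ ∞ f z) (u v : E) :
    coordHessian (christoffel g) f z u v = coordHessian (christoffel g) f z v u := by
  have h : IsSymmSndFDerivAt ℝ f z := hf.isSymmSndFDerivAt (by simpa using ENat.LEInfty.out)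
  rw [coordHessian, coordHessian, hg.christoffel_symm ht hfz, h u v]

/-- Gauss formula: the tangential part of `∇_u (df v)` is `df (∇_u v)`. -/
theorem apply_coordHessian (hG : IsMetricOn G s) (hs : IsOpen s) (hg : IsMetricOn g t)
    (ht : IsOpen t) (hf : ContDiffOn ℝ ∞ f s) (hst : Set.MapsTo f s t)
    (hGg : ∀ z ∈ s, ∀ u v, g (f z) (fderiv ℝ f z u) (fderiv ℝ f z v) = G z u v)
    (hz : z ∈ s) (u v c : E) :
    g (f z) (coordHessian (christoffel g) f z u v) (fderiv ℝ f z c)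
      = G z (christoffel G z u v) c := by
  have hfz := (hf z hz).contDiffAt (hs.mem_nhds hz)
  have hfd : HasFDerivAt f (fderiv ℝ f z) z := (hfz.differentiableAt (by simp)).hasFDerivAt
  have hfd2 : HasFDerivAt (fderiv ℝ f) (fderiv ℝ (fderiv ℝ f) z) z :=
    ((hfz.fderiv_right (m := ∞) (by simp)).differentiableAt (by simp)).hasFDerivAt
  have key (w a b : E) : fderiv ℝ G z w a b
      = g (f z) (coordHessian (christoffel g) f z w a) (fderiv ℝ f z b)
        + g (f z) (coordHessian (christoffel g) f z w b) (fderiv ℝ f z a) := by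
    have h1 := ((hG.differentiableAt hs hz).hasFDerivAt.clm_apply
      (hasFDerivAt_const a z)).clm_apply (hasFDerivAt_const b z)
    have h2 := (((hg.differentiableAt ht (hst hz)).hasFDerivAt.comp z hfd).clm_apply
      (hfd2.clm_apply (hasFDerivAt_const a z))).clm_apply (hfd2.clm_apply (hasFDerivAt_const b z))
    have h3 := h1.congr_of_eventuallyEq (Filter.eventually_of_mem (hs.mem_nhds hz)
      fun x hx ↦ hGg x hx a b)
    have h4 := congr($(h3.unique h2) w)
    simp only [ContinuousLinearMap.comp_zero, zero_add, ContinuousLinearMap.flip_apply, ContinuousLinearMap.comp_apply,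
      _root_.add_apply, Function.comp_apply, hg.fderiv_eq ht (hst hz)] at h4
    rw [h4, coordHessian, coordHessian, hg.symm (hst hz) _ (fderiv ℝ f z a)]
    simp only [map_add, _root_.add_apply]
    ring
  have symm := coordHessian_symm hg ht (hst hz) hfz
  rw [hG.apply_christoffel hz, key, key, key, symm v u, symm c u, symm c v]
  ring

/-- Codazzi equation for an umbilical immersion, in coordinates. -/
theorem coordCurvature_of_umbilical (hG : IsMetricOn G s) (hs : IsOpen s) (hg : IsMetricOn g t)
    (ht : IsOpen t) (hf : ContDiffOn ℝ ∞ f s) (hst : Set.MapsTo f s t) {h : E → F}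
    (hz : z ∈ s) (hh : DifferentiableAt ℝ h z)
    (humb : ∀ z ∈ s, ∀ u v, coordHessian (christoffel g) f z u v
      = fderiv ℝ f z (christoffel G z u v) + G z u v • h z) (w u v : E) :
    ∃ c, coordCurvature (christoffel g) (f z) (fderiv ℝ f z w) (fderiv ℝ f z u) (fderiv ℝ f z v)
      = fderiv ℝ f z c
        + G z u v • (fderiv ℝ h z w + christoffel g (f z) (fderiv ℝ f z w) (h z))
        - G z w v • (fderiv ℝ h z u + christoffel g (f z) (fderiv ℝ f z u) (h z)) := by
  have hfz := (hf z hz).contDiffAt (hs.mem_nhds hz)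
  have hfd : HasFDerivAt f (fderiv ℝ f z) z := (hfz.differentiableAt (by simp)).hasFDerivAt
  have hf1 : ContDiffAt ℝ ∞ (fderiv ℝ f) z := hfz.fderiv_right (by simp)
  have hfd2 : HasFDerivAt (fderiv ℝ f) (fderiv ℝ (fderiv ℝ f) z) z :=
    (hf1.differentiableAt (by simp)).hasFDerivAt
  have hfd3 : HasFDerivAt (fderiv ℝ (fderiv ℝ f)) (fderiv ℝ (fderiv ℝ (fderiv ℝ f)) z) z :=
    ((hf1.fderiv_right (m := ∞) (by simp)).differentiableAt (by simp)).hasFDerivAt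
  have hΓ : HasFDerivAt (christoffel g) (fderiv ℝ (christoffel g) (f z)) (f z) :=
    ((((hg.contDiffOn_christoffel ht) _ (hst hz)).contDiffAt
      (ht.mem_nhds (hst hz))).differentiableAt (by simp)).hasFDerivAt
  have hΓG : HasFDerivAt (christoffel G) (fderiv ℝ (christoffel G) z) z :=
    ((((hG.contDiffOn_christoffel hs) _ hz).contDiffAt
      (hs.mem_nhds hz)).differentiableAt (by simp)).hasFDerivAt
  have h3 : IsSymmSndFDerivAt ℝ (fderiv ℝ f) z := hf1.isSymmSndFDerivAt (by simpa using ENat.LEInfty.out)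
  have h2 : IsSymmSndFDerivAt ℝ f z := hfz.isSymmSndFDerivAt (by simpa using ENat.LEInfty.out)
  have key (w u v : E) :
      fderiv ℝ (fderiv ℝ (fderiv ℝ f)) z w u v
        + (fderiv ℝ (christoffel g) (f z) (fderiv ℝ f z w) (fderiv ℝ f z u) (fderiv ℝ f z v)
        + christoffel g (f z) (fderiv ℝ (fderiv ℝ f) z w u) (fderiv ℝ f z v)
        + christoffel g (f z) (fderiv ℝ f z u) (fderiv ℝ (fderiv ℝ f) z w v))
      = fderiv ℝ (fderiv ℝ f) z w (christoffel G z u v)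
        + fderiv ℝ f z (fderiv ℝ (christoffel G) z w u v)
        + (G z u v • fderiv ℝ h z w + fderiv ℝ G z w u v • h z) := by
    have e1 := ((hfd3.clm_apply (hasFDerivAt_const u z)).clm_apply (hasFDerivAt_const v z)).add
      (((hΓ.comp z hfd).clm_apply (hfd2.clm_apply (hasFDerivAt_const u z))).clm_apply
        (hfd2.clm_apply (hasFDerivAt_const v z)))
    have e2 := (hfd2.clm_apply ((hΓG.clm_apply (hasFDerivAt_const u z)).clm_apply
      (hasFDerivAt_const v z))).add
      ((((hG.differentiableAt hs hz).hasFDerivAt.clm_apply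
      (hasFDerivAt_const u z)).clm_apply (hasFDerivAt_const v z)).smul hh.hasFDerivAt)
    have e3 := e2.congr_of_eventuallyEq (Filter.eventually_of_mem (hs.mem_nhds hz)
      fun x hx ↦ humb x hx u v)
    have e4 := congr($(e1.unique e3) w)
    simp only [ContinuousLinearMap.comp_zero, zero_add, ContinuousLinearMap.flip_apply,
      ContinuousLinearMap.comp_apply, _root_.add_apply, Function.comp_apply, _root_.smul_apply,
      ContinuousLinearMap.smulRight_apply] at e4
    linear_combination (norm := module) e4
  have hs1 : fderiv ℝ (fderiv ℝ (fderiv ℝ f)) z w u v = fderiv ℝ (fderiv ℝ (fderiv ℝ f)) z u w v := by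
    rw [h3 w u]
  have humb' (u v : E) := humb z hz u v
  simp only [coordHessian] at humb'
  have k1 := key w u v
  have k2 := key u w v
  rw [hG.fderiv_eq hs hz] at k1 k2
  have hh1 := humb' w (christoffel G z u v)
  have hh2 := humb' u (christoffel G z w v)
  have hb1 := congr(christoffel g (f z) (fderiv ℝ f z w) $(humb' u v))
  have hb2 := congr(christoffel g (f z) (fderiv ℝ f z u) $(humb' w v))
  simp only [map_add, map_smul] at hb1 hb2
  refine ⟨christoffel G z w (christoffel G z u v) + fderiv ℝ (christoffel G) z w u v
    - (christoffel G z u (christoffel G z w v) + fderiv ℝ (christoffel G) z u w v), ?_⟩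
  rw [coordCurvature]
  simp only [map_add, map_sub, smul_add]
  rw [hs1] at k1
  rw [h2 u w, hG.christoffel_symm hs hz u w] at k2
  linear_combination (norm := module) k1 - k2 + hh1 - hh2 + hb1 - hb2

end Immersion

end Coordinates

section Charts

variable {E : Type*} [NormedAddCommGroup E] [NormedSpace ℝ E]
  {H : Type*} [TopologicalSpace H] (I : ModelWithCorners ℝ E H)
  {M : Type*} [TopologicalSpace M] [ChartedSpace H M] [IsManifold I ∞ M]

/-- The coordinates of tangent vectors at `x` in the preferred chart at `x₀`. -/
def coordMap (x₀ x : M) : TangentSpace I x →L[ℝ] E :=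
  (trivializationAt E (TangentSpace I : M → Type _) x₀).continuousLinearMapAt ℝ x

/-- The tangent vector at `x` with given coordinates in the preferred chart at `x₀`. -/
def coordFrame (x₀ x : M) : E →L[ℝ] TangentSpace I x :=
  (trivializationAt E (TangentSpace I : M → Type _) x₀).symmL ℝ x

variable {I} {x₀ x : M}

theorem coordFrame_coordMap (hx : x ∈ (chartAt H x₀).source) (u : TangentSpace I x) :
    coordFrame I x₀ x (coordMap I x₀ x u) = u :=
  (trivializationAt E (TangentSpace I : M → Type _) x₀).symmL_continuousLinearMapAt hx u

theorem coordMap_coordFrame (hx : x ∈ (chartAt H x₀).source) (a : E) :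
    coordMap I x₀ x (coordFrame I x₀ x a) = a :=
  (trivializationAt E (TangentSpace I : M → Type _) x₀).continuousLinearMapAt_symmL hx a

theorem coordMap_injective (hx : x ∈ (chartAt H x₀).source) :
    Function.Injective (coordMap I x₀ x) :=
  Function.LeftInverse.injective (coordFrame_coordMap hx)

theorem trivializationAt_snd_eq (hx : x ∈ (chartAt H x₀).source) (u : TangentSpace I x) :
    ((trivializationAt E (TangentSpace I : M → Type _) x₀) ⟨x, u⟩).2 = coordMap I x₀ x u := by
  rw [coordMap, Trivialization.continuousLinearMapAt_apply,
    Trivialization.coe_linearMapAt_of_mem _ hx]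

theorem coordMap_eq_mfderiv (hx : x ∈ (chartAt H x₀).source) :
    coordMap I x₀ x = mfderiv I 𝓘(ℝ, E) (extChartAt I x₀) x :=
  TangentBundle.continuousLinearMapAt_trivializationAt hx

theorem extend_eq_coordFrame (hx : x ∈ (chartAt H x₀).source) (v : TangentSpace I x₀) :
    extend E v x = coordFrame I x₀ x (coordMap I x₀ x₀ v) := by
  rw [← trivializationAt_snd_eq (mem_chart_source H x₀), coordFrame,
    Trivialization.symmL_apply]
  · rfl
  · exact hx

theorem chart_source_mem_nhds' (hx : x ∈ (chartAt H x₀).source) : (chartAt H x₀).source ∈ nhds x :=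
  (chartAt H x₀).open_source.mem_nhds hx

theorem mdifferentiableAt_section_iff_coordMap {Y : Π x : M, TangentSpace I x}
    (hx : x ∈ (chartAt H x₀).source) :
    MDiffAt (T% Y) x ↔ MDiffAt (fun y ↦ coordMap I x₀ y (Y y)) x := by
  rw [(trivializationAt E (TangentSpace I : M → Type _) x₀).mdifferentiableAt_section_iff I Y hx]
  have : (fun y ↦ coordMap I x₀ y (Y y)) =ᶠ[nhds x]
      fun y ↦ ((trivializationAt E (TangentSpace I : M → Type _) x₀) ⟨y, Y y⟩).2 :=
    Filter.eventually_of_mem (chart_source_mem_nhds' hx)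
      fun y hy ↦ (trivializationAt_snd_eq hy _).symm
  exact ⟨fun h ↦ h.congr_of_eventuallyEq this, fun h ↦ h.congr_of_eventuallyEq this.symm⟩

theorem contMDiffAt_coordFrame (hx : x ∈ (chartAt H x₀).source) (a : E) :
    CMDiffAt ∞ (T% (fun y : M ↦ coordFrame I x₀ y a)) x := by
  rw [(trivializationAt E (TangentSpace I : M → Type _) x₀).contMDiffAt_section_iff hx]
  refine (contMDiffAt_const (c := a)).congr_of_eventuallyEq ?_
  exact Filter.eventually_of_mem (chart_source_mem_nhds' hx) fun y hy ↦
    (trivializationAt_snd_eq hy _).trans (coordMap_coordFrame hy a)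

theorem mdifferentiableAt_coordFrame (hx : x ∈ (chartAt H x₀).source) (a : E) :
    MDiffAt (T% (fun y : M ↦ coordFrame I x₀ y a)) x :=
  (contMDiffAt_coordFrame hx a).mdifferentiableAt (by simp)

section Boundaryless

variable [I.Boundaryless]

theorem contMDiffAt_extChartAt_symm (hx : x ∈ (chartAt H x₀).source) :
    ContMDiffAt 𝓘(ℝ, E) I ∞ (extChartAt I x₀).symm (extChartAt I x₀ x) := by
  have h := (extChartAt I x₀).map_source (by rwa [extChartAt_source])
  exact (contMDiffOn_extChartAt_symm x₀ _ h).contMDiffAt ((isOpen_extChartAt_target x₀).mem_nhds h)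

theorem extChartAt_left_inv (hx : x ∈ (chartAt H x₀).source) :
    (extChartAt I x₀).symm (extChartAt I x₀ x) = x :=
  (extChartAt I x₀).left_inv (by rwa [extChartAt_source])

theorem extChartAt_mem_target (hx : x ∈ (chartAt H x₀).source) :
    extChartAt I x₀ x ∈ (extChartAt I x₀).target :=
  (extChartAt I x₀).map_source (by rwa [extChartAt_source])

theorem extChartAt_symm_mem_source {y : E} (hy : y ∈ (extChartAt I x₀).target) :
    (extChartAt I x₀).symm y ∈ (chartAt H x₀).source := by
  simpa using (extChartAt I x₀).map_target hy

theorem differentiableAt_comp_symm {V : Type*} [NormedAddCommGroup V] [NormedSpace ℝ V]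
    (hx : x ∈ (chartAt H x₀).source) {h : M → V} (hh : MDiffAt h x) :
    DifferentiableAt ℝ (fun y ↦ h ((extChartAt I x₀).symm y)) (extChartAt I x₀ x) := by
  rw [← mdifferentiableAt_iff_differentiableAt]
  refine MDifferentiableAt.comp (I' := I) (g := h) _ ?_
    ((contMDiffAt_extChartAt_symm hx).mdifferentiableAt (by simp))
  rwa [extChartAt_left_inv hx]

theorem mdifferentiableAt_of_comp_symm {V : Type*} [NormedAddCommGroup V] [NormedSpace ℝ V]
    (hx : x ∈ (chartAt H x₀).source) {h : M → V}
    (hh : DifferentiableAt ℝ (fun y ↦ h ((extChartAt I x₀).symm y)) (extChartAt I x₀ x)) :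
    MDiffAt h x := by
  have := hh.mdifferentiableAt.comp x (mdifferentiableAt_extChartAt (I := I) hx)
  refine this.congr_of_eventuallyEq (Filter.eventually_of_mem (chart_source_mem_nhds' hx)
    fun y hy ↦ congrArg h (extChartAt_left_inv hy).symm)

/-- The derivative of a function in coordinates. -/
theorem mvfderiv_eq_fderiv {V : Type*} [NormedAddCommGroup V] [NormedSpace ℝ V]
    (hx : x ∈ (chartAt H x₀).source) {h : M → V} (hh : MDiffAt h x) (u : TangentSpace I x) :
    mvfderiv I h x u = fderiv ℝ (fun y ↦ h ((extChartAt I x₀).symm y)) (extChartAt I x₀ x)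
      (coordMap I x₀ x u) := by
  have h1 := (differentiableAt_comp_symm hx hh).hasFDerivAt.hasMFDerivAt.comp x
    (mdifferentiableAt_extChartAt (I := I) hx).hasMFDerivAt
  have h2 := h1.congr_of_eventuallyEq (f₁ := h)
    (Filter.eventually_of_mem (chart_source_mem_nhds' hx) fun y hy ↦
      congrArg h (extChartAt_left_inv hy).symm)
  rw [coordMap_eq_mfderiv hx, mvfderiv, h2.mfderiv]
  rfl

theorem coordFrame_eq_inverse_mfderiv (hx : x ∈ (chartAt H x₀).source) :
    coordFrame I x₀ x = (mfderiv I 𝓘(ℝ, E) (extChartAt I x₀) x).inverse := by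
  rw [← coordMap_eq_mfderiv hx]
  refine (ContinuousLinearMap.inverse_eq ?_ ?_).symm
  · ext a; exact coordMap_coordFrame hx a
  · ext a; exact coordFrame_coordMap hx a

variable (I) in
/-- The coordinates of a vector field in the preferred chart at `x₀`. -/
def coordRep (x₀ : M) (Y : Π x : M, TangentSpace I x) (y : E) : E :=
  coordMap I x₀ ((extChartAt I x₀).symm y) (Y ((extChartAt I x₀).symm y))

theorem coordRep_extChartAt (hx : x ∈ (chartAt H x₀).source) (Y : Π x : M, TangentSpace I x) :
    coordRep I x₀ Y (extChartAt I x₀ x) = coordMap I x₀ x (Y x) := by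
  rw [coordRep, extChartAt_left_inv hx]

theorem differentiableAt_coordRep (hx : x ∈ (chartAt H x₀).source) {Y : Π x : M, TangentSpace I x}
    (hY : MDiffAt (T% Y) x) : DifferentiableAt ℝ (coordRep I x₀ Y) (extChartAt I x₀ x) :=
  differentiableAt_comp_symm hx ((mdifferentiableAt_section_iff_coordMap hx).1 hY)

variable (I) in
/-- The vector field on the model space whose coordinates are those of `Y`. -/
def coordField (x₀ : M) (Y : Π x : M, TangentSpace I x) (y : E) : TangentSpace 𝓘(ℝ, E) y :=
  let v : E := coordRep I x₀ Y y
  v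

theorem eventuallyEq_mpullback_coordField (hx : x ∈ (chartAt H x₀).source)
    (Y : Π x : M, TangentSpace I x) : ∀ᶠ y in nhds x,
      Y y = mpullback I 𝓘(ℝ, E) (extChartAt I x₀) (coordField I x₀ Y) y := by
  refine Filter.eventually_of_mem (chart_source_mem_nhds' hx) fun y hy ↦ ?_
  have h := coordFrame_coordMap hy (Y y)
  rw [coordFrame_eq_inverse_mfderiv hy, ← coordRep_extChartAt hy] at h
  exact h.symm

/-- The Lie bracket of vector fields in coordinates. -/
theorem mlieBracket_eq_coordFrame [CompleteSpace E] {X Y : Π x : M, TangentSpace I x}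
    (hx : x ∈ (chartAt H x₀).source) (hX : MDiffAt (T% X) x) (hY : MDiffAt (T% Y) x) :
    mlieBracket I X Y x = coordFrame I x₀ x
      (lieBracket ℝ (coordRep I x₀ X) (coordRep I x₀ Y) (extChartAt I x₀ x)) := by
  have : IsManifold I (minSmoothness ℝ 2) M := .of_le (n := ∞) (by simpa using ENat.LEInfty.out)
  have hd (Y : Π x : M, TangentSpace I x) (hY : MDiffAt (T% Y) x) :
      MDiffAt (T% (coordField I x₀ Y)) (extChartAt I x₀ x) := by
    rw [mdifferentiableAt_section]
    simpa using! (differentiableAt_coordRep hx hY).mdifferentiableAt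
  have h1 := mpullback_mlieBracket (n := ∞) (hd X hX) (hd Y hY)
    (contMDiffAt_extChartAt' (I := I) hx) (by simpa using ENat.LEInfty.out)
  rw [Filter.EventuallyEq.mlieBracket_vectorField_eq (eventuallyEq_mpullback_coordField hx X)
    (eventuallyEq_mpullback_coordField hx Y), ← h1, coordFrame_eq_inverse_mfderiv hx,
    ← mlieBracketWithin_univ, mlieBracketWithin_eq_lieBracketWithin,
    ← lieBracketWithin_univ (V := coordRep I x₀ X)]
  rfl

theorem coordRep_coordFrame (hx : x ∈ (chartAt H x₀).source) (a : E) :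
    coordRep I x₀ (fun x ↦ coordFrame I x₀ x a) =ᶠ[nhds (extChartAt I x₀ x)] fun _ ↦ a := by
  have h := (extChartAt I x₀).map_source (by rwa [extChartAt_source])
  refine Filter.eventually_of_mem ((isOpen_extChartAt_target x₀).mem_nhds h) fun y hy ↦ ?_
  exact coordMap_coordFrame (by simpa using (extChartAt I x₀).map_target hy) a

end Boundaryless

end Charts

section Metric

variable {E : Type*} [NormedAddCommGroup E] [NormedSpace ℝ E] [FiniteDimensional ℝ E]
  {H : Type*} [TopologicalSpace H] (I : ModelWithCorners ℝ E H)
  {M : Type*} [TopologicalSpace M] [ChartedSpace H M] [IsManifold I ∞ M]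
  [RiemannianBundle (fun x : M ↦ TangentSpace I x)]
  [IsContMDiffRiemannianBundle I ∞ E (fun x : M ↦ TangentSpace I x)] [I.Boundaryless]

/-- The Riemannian metric in the preferred chart at `x₀`. -/
def coordMetric (x₀ : M) (y : E) : E →L[ℝ] E →L[ℝ] ℝ :=
  (innerSL ℝ (E := TangentSpace I ((extChartAt I x₀).symm y))).bilinearComp
    (coordFrame I x₀ ((extChartAt I x₀).symm y)) (coordFrame I x₀ ((extChartAt I x₀).symm y))

variable {I} {x₀ x : M}

theorem coordMetric_apply (y a b : E) : coordMetric I x₀ y a b =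
    inner ℝ (coordFrame I x₀ ((extChartAt I x₀).symm y) a)
      (coordFrame I x₀ ((extChartAt I x₀).symm y) b) := rfl

theorem inner_eq_coordMetric (hx : x ∈ (chartAt H x₀).source) (u v : TangentSpace I x) :
    inner ℝ u v = coordMetric I x₀ (extChartAt I x₀ x) (coordMap I x₀ x u) (coordMap I x₀ x v) := by
  rw [coordMetric_apply, extChartAt_left_inv hx, coordFrame_coordMap hx, coordFrame_coordMap hx]

theorem isMetricOn_coordMetric (x₀ : M) :
    IsMetricOn (coordMetric I x₀) (extChartAt I x₀).target where
  contDiffOn := by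
    rw [contDiffOn_clm_apply]
    intro a
    rw [contDiffOn_clm_apply]
    intro b y hy
    have hx : (extChartAt I x₀).symm y ∈ (chartAt H x₀).source := by
      simpa using (extChartAt I x₀).map_target hy
    have h := ContMDiffAt.inner_bundle (IB := I) (E := fun y : M ↦ TangentSpace I y) (b := id)
      (v := fun x ↦ coordFrame I x₀ x a) (w := fun x ↦ coordFrame I x₀ x b)
      (contMDiffAt_coordFrame (I := I) hx a) (contMDiffAt_coordFrame (I := I) hx b)
    have h2 := contMDiffAt_extChartAt_symm (I := I) hx
    rw [(extChartAt I x₀).right_inv hy] at h2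
    exact (h.comp y h2).contDiffAt.contDiffWithinAt
  symm _ a b := by rw [coordMetric_apply, coordMetric_apply, real_inner_comm]
  pos {y} hy {a} ha := by
    have hx : (extChartAt I x₀).symm y ∈ (chartAt H x₀).source := by
      simpa using (extChartAt I x₀).map_target hy
    rw [coordMetric_apply]
    refine real_inner_self_pos.2 fun h ↦ ha ?_
    rw [← coordMap_coordFrame (I := I) hx a, h, map_zero]

end Metric

section VectorValued

variable {E : Type*} [NormedAddCommGroup E] [NormedSpace ℝ E]
  {H : Type*} [TopologicalSpace H] {I : ModelWithCorners ℝ E H}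
  {M : Type*} [TopologicalSpace M] [ChartedSpace H M]
  {V : Type*} [NormedAddCommGroup V] [NormedSpace ℝ V]
  {W : Type*} [NormedAddCommGroup W] [NormedSpace ℝ W]

theorem mvfderiv_congr {h k : M → V} {x : M} (hhk : h =ᶠ[nhds x] k) (u : TangentSpace I x) :
    mvfderiv I h x u = mvfderiv I k x u := by
  rw [mvfderiv, mvfderiv, hhk.mfderiv_eq]
  rfl

theorem mvfderiv_clm_apply_of_eq_zero [IsManifold I ∞ M] [I.Boundaryless] {A : M → V →L[ℝ] W}
    {h : M → V} {x : M} (hA : MDiffAt A x) (hh : MDiffAt h x) (h0 : h x = 0)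
    (u : TangentSpace I x) :
    mvfderiv I (fun y ↦ A y (h y)) x u = A x (mvfderiv I h x u) := by
  have hx := mem_chart_source H x
  rw [mvfderiv_eq_fderiv hx (hA.clm_apply hh), mvfderiv_eq_fderiv hx hh,
    fderiv_clm_apply (differentiableAt_comp_symm hx hA) (differentiableAt_comp_symm hx hh)]
  simp [h0]

end VectorValued

section LeviCivitaCoordinates

variable {E : Type*} [NormedAddCommGroup E] [NormedSpace ℝ E] [FiniteDimensional ℝ E]
  {H : Type*} [TopologicalSpace H] {I : ModelWithCorners ℝ E H}
  {M : Type*} [TopologicalSpace M] [ChartedSpace H M] [IsManifold I ∞ M]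
  [RiemannianBundle (fun x : M ↦ TangentSpace I x)]
  [IsContMDiffRiemannianBundle I ∞ E (fun x : M ↦ TangentSpace I x)] [I.Boundaryless]
  {x₀ x : M}

theorem mvfderiv_inner {Y Z : Π x : M, TangentSpace I x} (hx : x ∈ (chartAt H x₀).source)
    (hY : MDiffAt (T% Y) x) (hZ : MDiffAt (T% Z) x) (u : TangentSpace I x) :
    mvfderiv I (fun y ↦ inner ℝ (Y y) (Z y)) x u =
      fderiv ℝ (coordMetric I x₀) (extChartAt I x₀ x) (coordMap I x₀ x u)
        (coordMap I x₀ x (Y x)) (coordMap I x₀ x (Z x))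
      + coordMetric I x₀ (extChartAt I x₀ x)
        (fderiv ℝ (coordRep I x₀ Y) (extChartAt I x₀ x) (coordMap I x₀ x u))
        (coordMap I x₀ x (Z x))
      + coordMetric I x₀ (extChartAt I x₀ x) (coordMap I x₀ x (Y x))
        (fderiv ℝ (coordRep I x₀ Z) (extChartAt I x₀ x) (coordMap I x₀ x u)) := by
  rw [mvfderiv_eq_fderiv hx (mdifferentiableAt_inner hY hZ)]
  have hmem := extChartAt_mem_target (I := I) hx
  have hg := ((isMetricOn_coordMetric (I := I) x₀).differentiableAt (isOpen_extChartAt_target x₀)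
    hmem).hasFDerivAt
  have h := (hg.clm_apply (differentiableAt_coordRep hx hY).hasFDerivAt).clm_apply
    (differentiableAt_coordRep hx hZ).hasFDerivAt
  have h2 := h.congr_of_eventuallyEq (f₁ := fun y ↦ inner ℝ (Y ((extChartAt I x₀).symm y))
    (Z ((extChartAt I x₀).symm y))) (Filter.eventually_of_mem
      ((isOpen_extChartAt_target x₀).mem_nhds hmem) fun y hy ↦ by
      have hy' : (extChartAt I x₀).symm y ∈ (chartAt H x₀).source := by
        simpa using (extChartAt I x₀).map_target hy
      refine (inner_eq_coordMetric hy' _ _).trans ?_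
      rw [(extChartAt I x₀).right_inv hy]
      rfl)
  rw [h2.fderiv]
  simp only [_root_.add_apply, ContinuousLinearMap.comp_apply, ContinuousLinearMap.flip_apply,
    coordRep_extChartAt hx]
  ring

/-- The Levi-Civita connection in coordinates. -/
theorem coordMap_leviCivita {Y : Π x : M, TangentSpace I x} (hx : x ∈ (chartAt H x₀).source)
    (hY : MDiffAt (T% Y) x) (u : TangentSpace I x) :
    coordMap I x₀ x (leviCivita I M Y x u) =
      fderiv ℝ (coordRep I x₀ Y) (extChartAt I x₀ x) (coordMap I x₀ x u)
      + christoffel (coordMetric I x₀) (extChartAt I x₀ x) (coordMap I x₀ x u)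
        (coordMap I x₀ x (Y x)) := by
  have : CompleteSpace E := FiniteDimensional.complete ℝ E
  have hg := isMetricOn_coordMetric (I := I) x₀
  have hmem := extChartAt_mem_target (I := I) hx
  have ho := isOpen_extChartAt_target (I := I) x₀
  refine hg.eq_of_forall hmem fun c ↦ ?_
  set a := coordMap I x₀ x u with ha
  have hX := mdifferentiableAt_coordFrame (I := I) hx a
  have hZ := mdifferentiableAt_coordFrame (I := I) hx c
  have h := inner_leviCivitaFun hX hY hZ
  have hu : coordFrame I x₀ x a = u := coordFrame_coordMap hx u
  simp only [koszul, mvfderiv_inner hx hX hY, mvfderiv_inner hx hY hZ, mvfderiv_inner hx hZ hX,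
    mlieBracket_eq_coordFrame hx hX hY, mlieBracket_eq_coordFrame hx hX hZ,
    mlieBracket_eq_coordFrame hx hY hZ, inner_eq_coordMetric hx, lieBracket,
    coordMap_coordFrame hx, coordRep_extChartAt hx, (coordRep_coordFrame hx a).fderiv_eq,
    (coordRep_coordFrame hx c).fderiv_eq, fderiv_fun_const, Pi.zero_apply, _root_.zero_apply,
    map_zero, sub_zero, zero_sub, map_neg, _root_.neg_apply] at h
  rw [← leviCivita_apply, hu] at h
  rw [h, map_add, _root_.add_apply, hg.apply_christoffel hmem, hg.symm hmem a,
    hg.fderiv_symm ho hmem _ c a]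
  ring

/-- The Levi-Civita derivative of a coordinate vector field. -/
theorem coordMap_leviCivita_coordFrame (hx : x ∈ (chartAt H x₀).source) (a : E)
    (u : TangentSpace I x) :
    coordMap I x₀ x (leviCivita I M (fun y ↦ coordFrame I x₀ y a) x u) =
      christoffel (coordMetric I x₀) (extChartAt I x₀ x) (coordMap I x₀ x u) a := by
  rw [coordMap_leviCivita hx (mdifferentiableAt_coordFrame hx a),
    (coordRep_coordFrame hx a).fderiv_eq, coordMap_coordFrame hx]
  simp

theorem leviCivita_congr {Y Z : Π x : M, TangentSpace I x} (hY : MDiffAt (T% Y) x)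
    (hZ : MDiffAt (T% Z) x) (hYZ : ∀ᶠ y in nhds x, Y y = Z y) :
    leviCivita I M Y x = leviCivita I M Z x :=
  (leviCivita I M).isCovariantDerivativeOnUniv.congr_of_eventuallyEq hY hZ Filter.univ_mem hYZ

end LeviCivitaCoordinates

section Along

variable {E : Type*} [NormedAddCommGroup E] [NormedSpace ℝ E] [FiniteDimensional ℝ E]
  {H : Type*} [TopologicalSpace H] {I : ModelWithCorners ℝ E H} [I.Boundaryless]
  {S : Type*} [TopologicalSpace S] [ChartedSpace H S] [IsManifold I ∞ S]
  {E' : Type*} [NormedAddCommGroup E'] [NormedSpace ℝ E'] [FiniteDimensional ℝ E']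
  {H' : Type*} [TopologicalSpace H'] {J : ModelWithCorners ℝ E' H'} [J.Boundaryless]
  {M : Type*} [TopologicalSpace M] [ChartedSpace H' M] [IsManifold J ∞ M]
  [RiemannianBundle (fun x : M ↦ TangentSpace J x)]
  [IsContMDiffRiemannianBundle J ∞ E' (fun x : M ↦ TangentSpace J x)]

theorem mdifferentiableAt_coordMap_comp_coordFrame {x₀ x₁ x : M} (hx₀ : x ∈ (chartAt H' x₀).source)
    (hx₁ : x ∈ (chartAt H' x₁).source) :
    MDiffAt (fun y : M ↦ coordMap J x₁ y ∘L coordFrame J x₀ y) x := by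
  refine (mdifferentiableAt_coordChangeL (IB := J) (E := (TangentSpace J : M → Type _))
    (e := trivializationAt E' (TangentSpace J : M → Type _) x₀)
    (e' := trivializationAt E' (TangentSpace J : M → Type _) x₁) hx₀ hx₁).congr_of_eventuallyEq ?_
  refine Filter.eventually_of_mem (Filter.inter_mem (chart_source_mem_nhds' hx₀)
    (chart_source_mem_nhds' hx₁)) fun y hy ↦ ?_
  ext a
  refine ((Trivialization.coordChangeL_apply _ _ hy a).trans ?_).symm
  have h := trivializationAt_snd_eq hy.2 (coordFrame J x₀ y a)
  rw [coordFrame, Trivialization.symmL_apply] at h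
  · refine h.trans ?_
    rw [← Trivialization.symmL_apply (R := ℝ)]
    · rfl
    · exact hy.1
  · exact hy.1

/-- The covariant derivative along a map in the chart at an arbitrary point. -/
theorem coordMap_covariantDerivativeAlong {f : S → M} {η : Π q : S, TangentSpace J (f q)} {q : S}
    {x₀ : M} (hf : MDiffAt f q) (hx₀ : f q ∈ (chartAt H' x₀).source)
    (hη : MDiffAt (fun q' ↦ coordMap J x₀ (f q') (η q')) q) (v : TangentSpace I q) :
    coordMap J x₀ (f q) (covariantDerivativeAlong I J f η q v) =
      mvfderiv I (fun q' ↦ coordMap J x₀ (f q') (η q')) q v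
      + christoffel (coordMetric J x₀) (extChartAt J x₀ (f q))
        (coordMap J x₀ (f q) (mfderiv I J f q v)) (coordMap J x₀ (f q) (η q)) := by
  have hx₁ := mem_chart_source H' (f q)
  set c := coordMap J x₀ (f q) (η q) with hc
  have hcη : coordFrame J x₀ (f q) c = η q := coordFrame_coordMap hx₀ _
  set A : M → E' →L[ℝ] E' := fun y ↦ coordMap J (f q) y ∘L coordFrame J x₀ y with hA
  have hAd : MDiffAt A (f q) := mdifferentiableAt_coordMap_comp_coordFrame hx₀ hx₁
  have hAfd : MDiffAt (fun q' ↦ A (f q')) q := hAd.comp q hf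
  have hAc : MDiffAt (fun y ↦ A y c) (f q) := hAd.clm_apply mdifferentiableAt_const
  have hY := mdifferentiableAt_coordFrame (I := J) hx₀ c
  have h1 : leviCivita J M (extend E' (η q)) (f q) (mfderiv I J f q v)
      = leviCivita J M (fun y ↦ coordFrame J x₀ y c) (f q) (mfderiv I J f q v)
        - coordFrame J (f q) (f q) (mvfderiv I (fun q' ↦ A (f q') c) q v) := by
    have e1 := coordMap_leviCivita hx₁ hY (mfderiv I J f q v)
    have e2 := coordMap_leviCivita_coordFrame hx₁ (coordMap J (f q) (f q) (η q)) (mfderiv I J f q v)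
    rw [← leviCivita_congr (mdifferentiableAt_extend J E' (η q))
      (mdifferentiableAt_coordFrame hx₁ _) (Filter.eventually_of_mem
      (chart_source_mem_nhds' hx₁) fun y hy ↦ extend_eq_coordFrame hy (η q))] at e2
    have e3 : mvfderiv I (fun q' ↦ A (f q') c) q v
        = mvfderiv J (fun y ↦ A y c) (f q) (mfderiv I J f q v) :=
      mfderiv_comp_apply q hAc hf v
    refine coordMap_injective hx₁ ?_
    rw [map_sub, e2, e1, coordMap_coordFrame hx₁, e3, mvfderiv_eq_fderiv hx₁ hAc, hcη]
    exact (add_sub_cancel_left _ _).symm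
  have hev : (fun q' ↦ ((trivializationAt E' (TangentSpace J : M → Type _) (f q)) ⟨f q', η q'⟩).2)
      =ᶠ[nhds q] fun q' ↦ A (f q') (coordMap J x₀ (f q') (η q')) := by
    refine Filter.eventually_of_mem (hf.continuousAt.preimage_mem_nhds (Filter.inter_mem
      (chart_source_mem_nhds' hx₀) (chart_source_mem_nhds' hx₁))) fun q' hq' ↦ ?_
    refine (trivializationAt_snd_eq hq'.2 _).trans ?_
    simp [hA, coordFrame_coordMap hq'.1]
  have h2 : mvfderiv I (fun q' ↦
        ((trivializationAt E' (TangentSpace J : M → Type _) (f q)) ⟨f q', η q'⟩).2) q v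
      - mvfderiv I (fun q' ↦ A (f q') c) q v
      = A (f q) (mvfderiv I (fun q' ↦ coordMap J x₀ (f q') (η q')) q v) := by
    rw [mvfderiv_congr hev, ← _root_.sub_apply, ← mvfderiv_fun_sub (hAfd.clm_apply hη)
      (hAfd.clm_apply mdifferentiableAt_const)]
    simp only [← map_sub]
    have := mvfderiv_clm_apply_of_eq_zero hAfd (hη.sub (mdifferentiableAt_const (c := c)))
      (by simp [hc]) v
    refine this.trans ?_
    congr 1
    rw [mvfderiv_sub hη mdifferentiableAt_const, mvfderiv_const, sub_zero]
  have h3 : covariantDerivativeAlong I J f η q v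
      = coordFrame J (f q) (f q) (mvfderiv I (fun q' ↦
        ((trivializationAt E' (TangentSpace J : M → Type _) (f q)) ⟨f q', η q'⟩).2) q v)
      + leviCivita J M (extend E' (η q)) (f q) (mfderiv I J f q v) := rfl
  have h4 := congr(coordMap J x₀ (f q) (coordFrame J (f q) (f q) $h2))
  simp only [hA, ContinuousLinearMap.comp_apply, coordFrame_coordMap hx₁,
    coordMap_coordFrame hx₀, map_sub] at h4
  rw [h3, h1, ← coordMap_leviCivita_coordFrame hx₀, map_add, map_sub, ← h4]
  simp only [hA, ContinuousLinearMap.comp_apply]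
  abel

end Along

section CurvatureCoordinates

variable {E : Type*} [NormedAddCommGroup E] [NormedSpace ℝ E] [FiniteDimensional ℝ E]
  {H : Type*} [TopologicalSpace H] {I : ModelWithCorners ℝ E H}
  {M : Type*} [TopologicalSpace M] [ChartedSpace H M] [IsManifold I ∞ M]
  [RiemannianBundle (fun x : M ↦ TangentSpace I x)]
  [IsContMDiffRiemannianBundle I ∞ E (fun x : M ↦ TangentSpace I x)] [I.Boundaryless]
  {x₀ x : M}

theorem contDiffOn_christoffel_coordMetric (x₀ : M) :
    ContDiffOn ℝ ∞ (christoffel (coordMetric I x₀)) (extChartAt I x₀).target :=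
  (isMetricOn_coordMetric x₀).contDiffOn_christoffel (isOpen_extChartAt_target x₀)

theorem coordRep_extend (v : TangentSpace I x₀) {y : E} (hy : y ∈ (extChartAt I x₀).target) :
    coordRep I x₀ (extend E v) y = coordMap I x₀ x₀ v := by
  have h := extChartAt_symm_mem_source hy
  rw [coordRep, extend_eq_coordFrame h, coordMap_coordFrame h]

theorem mlieBracket_extend (u v : TangentSpace I x₀) :
    mlieBracket I (extend E u) (extend E v) x₀ = 0 := by
  have : CompleteSpace E := FiniteDimensional.complete ℝ E
  have hx := mem_chart_source H x₀
  have ev (u : TangentSpace I x₀) : coordRep I x₀ (extend E u) =ᶠ[nhds (extChartAt I x₀ x₀)]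
      fun _ ↦ coordMap I x₀ x₀ u :=
    Filter.eventually_of_mem ((isOpen_extChartAt_target x₀).mem_nhds (extChartAt_mem_target hx))
      fun y hy ↦ coordRep_extend u hy
  rw [mlieBracket_eq_coordFrame hx (mdifferentiableAt_extend I E u)
    (mdifferentiableAt_extend I E v), lieBracket, (ev u).fderiv_eq, (ev v).fderiv_eq]
  simp

/-- The second covariant derivative of coordinate vector fields. -/
theorem coordMap_leviCivita_leviCivita_extend (u v w : TangentSpace I x₀) :
    coordMap I x₀ x₀ (leviCivita I M (fun y ↦ leviCivita I M
      (extend E w : Π y : M, TangentSpace I y) y ((extend E v : Π y : M, TangentSpace I y) y)) x₀ u)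
    = fderiv ℝ (christoffel (coordMetric I x₀)) (extChartAt I x₀ x₀) (coordMap I x₀ x₀ u)
        (coordMap I x₀ x₀ v) (coordMap I x₀ x₀ w)
      + christoffel (coordMetric I x₀) (extChartAt I x₀ x₀) (coordMap I x₀ x₀ u)
        (christoffel (coordMetric I x₀) (extChartAt I x₀ x₀) (coordMap I x₀ x₀ v)
          (coordMap I x₀ x₀ w)) := by
  have hx := mem_chart_source H x₀
  have hmem := extChartAt_mem_target (I := I) hx
  have hnhds := (isOpen_extChartAt_target (I := I) x₀).mem_nhds hmem
  set Y : Π y : M, TangentSpace I y := fun y ↦ leviCivita I M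
      (extend E w : Π y : M, TangentSpace I y) y ((extend E v : Π y : M, TangentSpace I y) y) with hY
  have hYc {x : M} (hx' : x ∈ (chartAt H x₀).source) : coordMap I x₀ x (Y x) =
      christoffel (coordMetric I x₀) (extChartAt I x₀ x) (coordMap I x₀ x₀ v)
        (coordMap I x₀ x₀ w) := by
    have hev : ∀ᶠ y in nhds x, coordFrame I x₀ y (coordMap I x₀ x₀ w)
        = (extend E w : Π y : M, TangentSpace I y) y :=
      Filter.eventually_of_mem (chart_source_mem_nhds' hx')
        fun _ hy ↦ (extend_eq_coordFrame hy w).symm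
    have hd : MDiffAt (T% (extend E w : Π y : M, TangentSpace I y)) x :=
      (mdifferentiableAt_coordFrame hx' (coordMap I x₀ x₀ w)).congr_of_eventuallyEq
        (hev.mono fun y hy ↦ by simp only [hy])
    rw [hY]
    dsimp only
    rw [← leviCivita_congr (mdifferentiableAt_coordFrame hx' _) hd hev,
      coordMap_leviCivita_coordFrame hx', extend_eq_coordFrame hx' v, coordMap_coordFrame hx']
  have hΓ := (((contDiffOn_christoffel_coordMetric (I := I) x₀) _ hmem).contDiffAt
    hnhds).differentiableAt (by simp)
  have hYr : coordRep I x₀ Y =ᶠ[nhds (extChartAt I x₀ x₀)]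
      fun y ↦ christoffel (coordMetric I x₀) y (coordMap I x₀ x₀ v) (coordMap I x₀ x₀ w) := by
    refine Filter.eventually_of_mem hnhds fun y hy ↦ ?_
    rw [coordRep, hYc (extChartAt_symm_mem_source hy), (extChartAt I x₀).right_inv hy]
  have hder := (hΓ.hasFDerivAt.clm_apply (hasFDerivAt_const (coordMap I x₀ x₀ v) _)).clm_apply
    (hasFDerivAt_const (coordMap I x₀ x₀ w) _)
  have hYd : MDiffAt (T% Y) x₀ := by
    rw [mdifferentiableAt_section_iff_coordMap hx]
    exact mdifferentiableAt_of_comp_symm hx (hder.congr_of_eventuallyEq hYr).differentiableAt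
  rw [coordMap_leviCivita hx hYd, hYc hx, hYr.fderiv_eq, hder.fderiv]
  simp [ContinuousLinearMap.flip_apply]

/-- The curvature tensor in coordinates. -/
theorem coordMap_curvature (u v w : TangentSpace I x₀) :
    coordMap I x₀ x₀ (curvature I x₀ u v w) =
      coordCurvature (christoffel (coordMetric I x₀)) (extChartAt I x₀ x₀) (coordMap I x₀ x₀ u)
        (coordMap I x₀ x₀ v) (coordMap I x₀ x₀ w) := by
  simp only [curvature]
  rw [mlieBracket_extend, map_zero, sub_zero, map_sub, coordMap_leviCivita_leviCivita_extend,
    coordMap_leviCivita_leviCivita_extend, coordCurvature]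
  abel

end CurvatureCoordinates

section NormalPart

variable {E : Type*} [NormedAddCommGroup E] [NormedSpace ℝ E] [FiniteDimensional ℝ E]
  {H : Type*} [TopologicalSpace H] {I : ModelWithCorners ℝ E H}
  {S : Type*} [TopologicalSpace S] [ChartedSpace H S] [IsManifold I ∞ S]
  {E' : Type*} [NormedAddCommGroup E'] [NormedSpace ℝ E'] [FiniteDimensional ℝ E']
  {H' : Type*} [TopologicalSpace H'] {J : ModelWithCorners ℝ E' H'}
  {M : Type*} [TopologicalSpace M] [ChartedSpace H' M] [IsManifold J ∞ M]
  [RiemannianBundle (fun x : M ↦ TangentSpace J x)] {f : S → M} {p : S}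

theorem mfderiv_mem_tangentSubspace (u : TangentSpace I p) :
    mfderiv I J f p u ∈ tangentSubspace I J f p := ⟨u, rfl⟩

theorem normalPart_eq_zero_iff (z : TangentSpace J (f p)) :
    normalPart I J f p z = 0 ↔ z ∈ tangentSubspace I J f p := by
  rw [normalPart, Submodule.starProjection_apply_eq_zero_iff, Submodule.orthogonal_orthogonal]

theorem normalPart_mfderiv (u : TangentSpace I p) :
    normalPart I J f p (mfderiv I J f p u) = 0 :=
  (normalPart_eq_zero_iff _).2 (mfderiv_mem_tangentSubspace u)

theorem normalPart_eq_self {z : TangentSpace J (f p)}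
    (hz : ∀ u, inner ℝ (mfderiv I J f p u) z = 0) : normalPart I J f p z = z := by
  rw [normalPart, Submodule.starProjection_eq_self_iff, Submodule.mem_orthogonal]
  rintro _ ⟨u, rfl⟩
  exact hz u

theorem normalPart_add (y z : TangentSpace J (f p)) :
    normalPart I J f p (y + z) = normalPart I J f p y + normalPart I J f p z := map_add _ _ _

theorem normalPart_sub (y z : TangentSpace J (f p)) :
    normalPart I J f p (y - z) = normalPart I J f p y - normalPart I J f p z := map_sub _ _ _

theorem normalPart_smul (a : ℝ) (z : TangentSpace J (f p)) :
    normalPart I J f p (a • z) = a • normalPart I J f p z := map_smul _ _ _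

theorem normalPart_sum {ι : Type*} (s : Finset ι) (z : ι → TangentSpace J (f p)) :
    normalPart I J f p (∑ i ∈ s, z i) = ∑ i ∈ s, normalPart I J f p (z i) := map_sum _ _ _

end NormalPart

section ImmersionCoordinates

variable {E : Type*} [NormedAddCommGroup E] [NormedSpace ℝ E] [FiniteDimensional ℝ E]
  {H : Type*} [TopologicalSpace H] (I : ModelWithCorners ℝ E H) [I.Boundaryless]
  {S : Type*} [TopologicalSpace S] [ChartedSpace H S] [IsManifold I ∞ S]
  {E' : Type*} [NormedAddCommGroup E'] [NormedSpace ℝ E'] [FiniteDimensional ℝ E']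
  {H' : Type*} [TopologicalSpace H'] (J : ModelWithCorners ℝ E' H') [J.Boundaryless]
  {M : Type*} [TopologicalSpace M] [ChartedSpace H' M] [IsManifold J ∞ M]

/-- The domain of the coordinate expression of `f` in the preferred charts at `p` and `f p`. -/
def chartDomain (f : S → M) (p : S) : Set E :=
  (extChartAt I p).target ∩ (fun z ↦ f ((extChartAt I p).symm z)) ⁻¹' (chartAt H' (f p)).source

/-- The coordinate expression of `f` in the preferred charts at `p` and `f p`. -/
def coordExpr (f : S → M) (p : S) (z : E) : E' :=
  extChartAt J (f p) (f ((extChartAt I p).symm z))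

/-- The coordinates of a vector field along `f` in the preferred charts at `p` and `f p`. -/
def coordRepAlong (f : S → M) (p : S) (η : Π q : S, TangentSpace J (f q)) (z : E) : E' :=
  coordMap J (f p) (f ((extChartAt I p).symm z)) (η ((extChartAt I p).symm z))

variable {I J} {f : S → M} {p q : S}

/-- Points at which the coordinate expression of `f` at `p` is defined. -/
theorem extChartAt_mem_chartDomain (hq : q ∈ (chartAt H p).source)
    (hfq : f q ∈ (chartAt H' (f p)).source) :
    extChartAt I p q ∈ chartDomain (H' := H') I f p := by
  refine ⟨extChartAt_mem_target hq, ?_⟩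
  rw [Set.mem_preimage, extChartAt_left_inv hq]
  exact hfq

theorem isOpen_chartDomain (hf : ContMDiff I J ∞ f) :
    IsOpen (chartDomain (H' := H') I f p) :=
  (hf.continuous.comp_continuousOn (continuousOn_extChartAt_symm p)).isOpen_inter_preimage
    (isOpen_extChartAt_target p) (chartAt H' (f p)).open_source

theorem mapsTo_coordExpr :
    Set.MapsTo (coordExpr I J f p) (chartDomain (H' := H') I f p) (extChartAt J (f p)).target :=
  fun _ hz ↦ extChartAt_mem_target hz.2

theorem contDiffOn_coordExpr (hf : ContMDiff I J ∞ f) :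
    ContDiffOn ℝ ∞ (coordExpr I J f p) (chartDomain (H' := H') I f p) := by
  intro z hz
  have h1 : ContMDiffAt 𝓘(ℝ, E) I ∞ (extChartAt I p).symm z :=
    (contMDiffOn_extChartAt_symm p _ hz.1).contMDiffAt ((isOpen_extChartAt_target p).mem_nhds hz.1)
  have h2 := (contMDiffAt_extChartAt' (I := J) (n := ∞) hz.2).comp z (hf.contMDiffAt.comp z h1)
  exact h2.contDiffAt.contDiffWithinAt

theorem coordRepAlong_extChartAt (hq : q ∈ (chartAt H p).source)
    (η : Π q : S, TangentSpace J (f q)) :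
    coordRepAlong I J f p η (extChartAt I p q) = coordMap J (f p) (f q) (η q) := by
  rw [coordRepAlong, extChartAt_left_inv hq]

theorem coordMap_mfderiv (hf : ContMDiff I J ∞ f) (hq : q ∈ (chartAt H p).source)
    (hfq : f q ∈ (chartAt H' (f p)).source) (u : TangentSpace I q) :
    coordMap J (f p) (f q) (mfderiv I J f q u)
      = fderiv ℝ (coordExpr I J f p) (extChartAt I p q) (coordMap I p q u) := by
  have hfd : MDiffAt f q := (hf q).mdifferentiableAt (by simp)
  have hd := mdifferentiableAt_extChartAt (I := J) hfq
  have h := mvfderiv_eq_fderiv (I := I) hq (h := fun q ↦ extChartAt J (f p) (f q))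
    (hd.comp q hfd) u
  rw [coordMap_eq_mfderiv hfq]
  exact (mfderiv_comp_apply q hd hfd u).symm.trans h

variable [RiemannianBundle (fun x : M ↦ TangentSpace J x)]
  [IsContMDiffRiemannianBundle J ∞ E' (fun x : M ↦ TangentSpace J x)]

/-- The covariant derivative along `f` in coordinates. -/
theorem coordMap_covariantDerivativeAlong_coordRepAlong (hf : ContMDiff I J ∞ f) (hq : q ∈ (chartAt H p).source)
    (hfq : f q ∈ (chartAt H' (f p)).source) {η : Π q : S, TangentSpace J (f q)}
    (hη : DifferentiableAt ℝ (coordRepAlong I J f p η) (extChartAt I p q)) (v : TangentSpace I q) :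
    coordMap J (f p) (f q) (covariantDerivativeAlong I J f η q v) =
      fderiv ℝ (coordRepAlong I J f p η) (extChartAt I p q) (coordMap I p q v)
      + christoffel (coordMetric J (f p)) (coordExpr I J f p (extChartAt I p q))
        (fderiv ℝ (coordExpr I J f p) (extChartAt I p q) (coordMap I p q v))
        (coordRepAlong I J f p η (extChartAt I p q)) := by
  have hd : MDiffAt (fun q' ↦ coordMap J (f p) (f q') (η q')) q :=
    mdifferentiableAt_of_comp_symm hq hη
  rw [coordMap_covariantDerivativeAlong ((hf q).mdifferentiableAt (by simp)) hfq hd,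
    mvfderiv_eq_fderiv hq hd, coordMap_mfderiv hf hq hfq, coordRepAlong_extChartAt hq, coordExpr,
    extChartAt_left_inv hq]
  rfl

/-- The second fundamental form in coordinates. -/
theorem secondFundamentalForm_eq_normalPart_coordHessian (hf : ContMDiff I J ∞ f)
    (hq : q ∈ (chartAt H p).source) (hfq : f q ∈ (chartAt H' (f p)).source)
    (u v : TangentSpace I q) :
    secondFundamentalForm I J f q u v = normalPart I J f q (coordFrame J (f p) (f q)
      (coordHessian (christoffel (coordMetric J (f p))) (coordExpr I J f p) (extChartAt I p q)
        (coordMap I p q u) (coordMap I p q v))) := by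
  have hmem := extChartAt_mem_chartDomain (I := I) hq hfq
  have hnhds := (isOpen_chartDomain (p := p) hf).mem_nhds hmem
  set V : Π q' : S, TangentSpace I q' := extend E v
  have hV : DifferentiableAt ℝ (coordRep I p V) (extChartAt I p q) :=
    differentiableAt_coordRep hq (mdifferentiableAt_extend I E v)
  have hF := (contDiffOn_coordExpr hf _ hmem).contDiffAt hnhds
  have hF1 : HasFDerivAt (fderiv ℝ (coordExpr I J f p)) _ (extChartAt I p q) :=
    ((hF.fderiv_right (m := ∞) (by simp)).differentiableAt (by simp)).hasFDerivAt
  have hrep : coordRepAlong I J f p (fun q' ↦ mfderiv I J f q' (V q'))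
      =ᶠ[nhds (extChartAt I p q)] fun z ↦ fderiv ℝ (coordExpr I J f p) z (coordRep I p V z) := by
    refine Filter.eventually_of_mem hnhds fun z hz ↦ ?_
    rw [coordRepAlong, coordMap_mfderiv hf (extChartAt_symm_mem_source hz.1) hz.2,
      (extChartAt I p).right_inv hz.1]
    rfl
  have hder := (hF1.clm_apply hV.hasFDerivAt).congr_of_eventuallyEq hrep
  have h := coordMap_covariantDerivativeAlong_coordRepAlong hf hq hfq hder.differentiableAt u
  rw [hder.fderiv, coordRepAlong_extChartAt hq, coordMap_mfderiv hf hq hfq] at h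
  have hVq : V q = v := extend_apply_self E v
  rw [secondFundamentalForm, ← sub_eq_zero, ← normalPart_sub, normalPart_eq_zero_iff]
  refine ⟨coordFrame I p q (fderiv ℝ (coordRep I p V) (extChartAt I p q) (coordMap I p q u)), ?_⟩
  refine coordMap_injective hfq ?_
  rw [map_sub, h, coordMap_coordFrame hfq]
  refine (coordMap_mfderiv hf hq hfq _).trans ?_
  rw [coordMap_coordFrame hq, coordHessian, coordRep_extChartAt hq, hVq]
  simp only [_root_.add_apply, ContinuousLinearMap.comp_apply, ContinuousLinearMap.flip_apply]
  abel

variable [RiemannianBundle (fun p : S ↦ TangentSpace I p)]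
  [IsContMDiffRiemannianBundle I ∞ E (fun p : S ↦ TangentSpace I p)]

theorem coordMetric_coordExpr (hf : IsIsometricImmersion I J f) {z : E}
    (hz : z ∈ chartDomain (H' := H') I f p) (a b : E) :
    coordMetric J (f p) (coordExpr I J f p z) (fderiv ℝ (coordExpr I J f p) z a)
      (fderiv ℝ (coordExpr I J f p) z b) = coordMetric I p z a b := by
  have hq := extChartAt_symm_mem_source hz.1
  have h := hf.inner_mfderiv _ (coordFrame I p ((extChartAt I p).symm z) a)
    (coordFrame I p ((extChartAt I p).symm z) b)
  rw [inner_eq_coordMetric hz.2, coordMap_mfderiv hf.contMDiff hq hz.2,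
    coordMap_mfderiv hf.contMDiff hq hz.2, coordMap_coordFrame hq, coordMap_coordFrame hq,
    (extChartAt I p).right_inv hz.1] at h
  exact h

/-- The Gauss formula for an umbilical immersion in coordinates. -/
theorem coordHessian_of_umbilical (hf : IsIsometricImmersion I J f) (humb : IsUmbilical I J f)
    {z : E} (hz : z ∈ chartDomain (H' := H') I f p) (a b : E) :
    coordHessian (christoffel (coordMetric J (f p))) (coordExpr I J f p) z a b
      = fderiv ℝ (coordExpr I J f p) z (christoffel (coordMetric I p) z a b)
        + coordMetric I p z a b • coordRepAlong I J f p (meanCurvatureVector I J f) z := by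
  set q := (extChartAt I p).symm z with hqz
  have hq : q ∈ (chartAt H p).source := extChartAt_symm_mem_source hz.1
  have hfq : f q ∈ (chartAt H' (f p)).source := hz.2
  have hzq : extChartAt I p q = z := (extChartAt I p).right_inv hz.1
  have h1 := secondFundamentalForm_eq_normalPart_coordHessian hf.contMDiff hq hfq
    (coordFrame I p q a) (coordFrame I p q b)
  rw [coordMap_coordFrame hq, coordMap_coordFrame hq, hzq] at h1
  set B := coordHessian (christoffel (coordMetric J (f p))) (coordExpr I J f p) z a b with hB
  set T := christoffel (coordMetric I p) z a b with hT
  have hg := isMetricOn_coordMetric (I := J) (f p)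
  have hft : mfderiv I J f q (coordFrame I p q T)
      = coordFrame J (f p) (f q) (fderiv ℝ (coordExpr I J f p) z T) := by
    refine coordMap_injective hfq ?_
    rw [coordMap_mfderiv hf.contMDiff hq hfq, coordMap_coordFrame hq, coordMap_coordFrame hfq, hzq]
  have hF : extChartAt J (f p) (f q) = coordExpr I J f p z := rfl
  have h2 : normalPart I J f q (coordFrame J (f p) (f q) (B - fderiv ℝ (coordExpr I J f p) z T))
      = coordFrame J (f p) (f q) (B - fderiv ℝ (coordExpr I J f p) z T) := by
    refine normalPart_eq_self fun u ↦ ?_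
    rw [inner_eq_coordMetric hfq, coordMap_mfderiv hf.contMDiff hq hfq, coordMap_coordFrame hfq,
      hzq, hF, hg.symm (mapsTo_coordExpr hz), map_sub, _root_.sub_apply,
      apply_coordHessian (s := chartDomain (H' := H') I f p)
        (G := coordMetric I p) ?_ (isOpen_chartDomain hf.contMDiff) hg
        (isOpen_extChartAt_target _) (contDiffOn_coordExpr hf.contMDiff) mapsTo_coordExpr
        (fun z hz u v ↦ coordMetric_coordExpr hf hz u v) hz, coordMetric_coordExpr hf hz, sub_self]
    exact (isMetricOn_coordMetric p).mono Set.inter_subset_left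
  rw [map_sub, normalPart_sub, ← hft, normalPart_mfderiv, ← h1, humb, sub_zero] at h2
  have h3 := congr(coordMap J (f p) (f q) $h2)
  rw [hft, map_smul, map_sub, coordMap_coordFrame hfq, coordMap_coordFrame hfq] at h3
  rw [← sub_eq_iff_eq_add', ← h3]
  rfl

theorem differentiableAt_coordRepAlong_meanCurvatureVector [Nontrivial E]
    (hf : IsIsometricImmersion I J f) (humb : IsUmbilical I J f) {z : E}
    (hz : z ∈ chartDomain (H' := H') I f p) :
    DifferentiableAt ℝ (coordRepAlong I J f p (meanCurvatureVector I J f)) z := by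
  obtain ⟨a, ha⟩ := exists_ne (0 : E)
  have hnhds := (isOpen_chartDomain (p := p) hf.contMDiff).mem_nhds hz
  have hF := (contDiffOn_coordExpr hf.contMDiff _ hz).contDiffAt hnhds
  have hF1 : ContDiffAt ℝ ∞ (fderiv ℝ (coordExpr I J f p)) z := hF.fderiv_right (m := ∞) (by simp)
  have hF2 : DifferentiableAt ℝ (fderiv ℝ (fderiv ℝ (coordExpr I J f p))) z :=
    (hF1.fderiv_right (m := ∞) (by simp)).differentiableAt (by simp)
  have hΓ := ((contDiffOn_christoffel_coordMetric (I := J) (f p) _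
    (mapsTo_coordExpr hz)).contDiffAt ((isOpen_extChartAt_target (f p)).mem_nhds
    (mapsTo_coordExpr hz))).differentiableAt (by simp)
  have hΓS := ((contDiffOn_christoffel_coordMetric (I := I) p _ hz.1).contDiffAt
    ((isOpen_extChartAt_target p).mem_nhds hz.1)).differentiableAt (by simp)
  have hG := isMetricOn_coordMetric (I := I) p
  have hGd := hG.differentiableAt (isOpen_extChartAt_target p) hz.1
  have hF1d := hF1.differentiableAt (by simp)
  have hc (c : E) : DifferentiableAt ℝ (fun _ : E ↦ c) z := differentiableAt_const c
  have hGaa := (hGd.clm_apply (hc a)).clm_apply (hc a)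
  have hH : DifferentiableAt ℝ (fun z ↦ coordHessian (christoffel (coordMetric J (f p)))
      (coordExpr I J f p) z a a) z :=
    ((hF2.clm_apply (hc a)).clm_apply (hc a)).add
      (((hΓ.comp z (hF.differentiableAt (by simp))).clm_apply
        (hF1d.clm_apply (hc a))).clm_apply (hF1d.clm_apply (hc a)))
  have hT := hF1d.clm_apply ((hΓS.clm_apply (hc a)).clm_apply (hc a))
  refine ((hGaa.inv (hG.pos hz.1 ha).ne').smul (hH.sub hT)).congr_of_eventuallyEq ?_
  refine Filter.eventually_of_mem hnhds fun z hz ↦ ?_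
  simp only [Pi.smul_apply', Pi.inv_apply, Pi.sub_apply]
  rw [coordHessian_of_umbilical hf humb hz, add_sub_cancel_left,
    inv_smul_smul₀ (hG.pos hz.1 ha).ne']

/-- The Codazzi equation for an umbilical immersion. -/
theorem normalPart_curvature_of_umbilical [Nontrivial E] (hf : IsIsometricImmersion I J f)
    (humb : IsUmbilical I J f) (p : S) (u v w : TangentSpace I p) :
    normalPart I J f p (curvature J (f p) (mfderiv I J f p u) (mfderiv I J f p v)
      (mfderiv I J f p w))
    = (inner ℝ v w : ℝ) • normalDerivative I J f (meanCurvatureVector I J f) p u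
      - (inner ℝ u w : ℝ) • normalDerivative I J f (meanCurvatureVector I J f) p v := by
  have hp := mem_chart_source H p
  have hfp := mem_chart_source H' (f p)
  have hz := extChartAt_mem_chartDomain (I := I) hp hfp
  have hh := differentiableAt_coordRepAlong_meanCurvatureVector hf humb hz
  obtain ⟨c, hc⟩ := coordCurvature_of_umbilical (s := chartDomain (H' := H') I f p)
    (G := coordMetric I p) (g := coordMetric J (f p)) (f := coordExpr I J f p)
    ((isMetricOn_coordMetric p).mono Set.inter_subset_left)
    (isOpen_chartDomain hf.contMDiff) (isMetricOn_coordMetric (f p))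
    (isOpen_extChartAt_target _) (contDiffOn_coordExpr hf.contMDiff) mapsTo_coordExpr hz hh
    (fun z hz a b ↦ coordHessian_of_umbilical hf humb hz a b)
    (coordMap I p p u) (coordMap I p p v) (coordMap I p p w)
  have hcov := coordMap_covariantDerivativeAlong_coordRepAlong hf.contMDiff hp hfp hh
  rw [← hcov, ← hcov, ← inner_eq_coordMetric hp, ← inner_eq_coordMetric hp,
    ← coordMap_mfderiv hf.contMDiff hp hfp, ← coordMap_mfderiv hf.contMDiff hp hfp,
    ← coordMap_mfderiv hf.contMDiff hp hfp] at hc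
  have hx : coordExpr I J f p (extChartAt I p p) = extChartAt J (f p) (f p) := by
    rw [coordExpr, extChartAt_left_inv hp]
  rw [hx, ← coordMap_curvature, ← coordMap_coordFrame (I := I) hp c,
    ← coordMap_mfderiv hf.contMDiff hp hfp, ← map_smul, ← map_smul, ← map_add, ← map_sub] at hc
  rw [coordMap_injective hfp hc, normalPart_sub, normalPart_add, normalPart_mfderiv,
    normalPart_smul, normalPart_smul, zero_add]
  rfl

end ImmersionCoordinates

section Equivalence

variable {E : Type*} [NormedAddCommGroup E] [NormedSpace ℝ E] [FiniteDimensional ℝ E]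
  {H : Type*} [TopologicalSpace H] {I : ModelWithCorners ℝ E H}
  {S : Type*} [TopologicalSpace S] [ChartedSpace H S] [IsManifold I ∞ S]
  [RiemannianBundle (fun p : S ↦ TangentSpace I p)]
  {E' : Type*} [NormedAddCommGroup E'] [NormedSpace ℝ E'] [FiniteDimensional ℝ E']
  {H' : Type*} [TopologicalSpace H'] {J : ModelWithCorners ℝ E' H'}
  {M : Type*} [TopologicalSpace M] [ChartedSpace H' M] [IsManifold J ∞ M]
  [RiemannianBundle (fun x : M ↦ TangentSpace J x)]
  [IsContMDiffRiemannianBundle J ∞ E' (fun x : M ↦ TangentSpace J x)] {f : S → M}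

theorem normalDerivative_sum (η : Π q : S, TangentSpace J (f q)) (p : S) {ι : Type*}
    (s : Finset ι) (a : ι → ℝ) (v : ι → TangentSpace I p) :
    normalDerivative I J f η p (∑ i ∈ s, a i • v i)
      = ∑ i ∈ s, a i • normalDerivative I J f η p (v i) := by
  simp only [normalDerivative, covariantDerivativeAlong, normalPart, map_sum, map_smul, map_add,
    smul_add, Finset.sum_add_distrib]

theorem IsVerySpecial.isSpecial (h : IsVerySpecial I J f) : IsSpecial I J f :=
  fun p _ w ↦ Submodule.sum_mem _ fun _ _ ↦ h p _ w

variable [IsContMDiffRiemannianBundle I ∞ E (fun p : S ↦ TangentSpace I p)]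
  [I.Boundaryless] [J.Boundaryless]

theorem HasParallelMeanCurvature.isVerySpecial [Nontrivial E] (hf : IsIsometricImmersion I J f)
    (humb : IsUmbilical I J f) (h : HasParallelMeanCurvature I J f) : IsVerySpecial I J f := by
  intro p v w
  rw [← normalPart_eq_zero_iff, normalPart_curvature_of_umbilical hf humb, h p v, h p w]
  simp

/-- The Codazzi equation traced over an orthonormal basis. -/
theorem normalPart_sum_curvature_of_umbilical [Nontrivial E] (hf : IsIsometricImmersion I J f)
    (humb : IsUmbilical I J f) (p : S) {ι : Type*} [Fintype ι]
    (b : OrthonormalBasis ι ℝ (TangentSpace I p)) (w : TangentSpace I p) :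
    normalPart I J f p (∑ i, curvature J (f p) (mfderiv I J f p (b i)) (mfderiv I J f p w)
      (mfderiv I J f p (b i)))
    = (1 - Fintype.card ι : ℝ) • normalDerivative I J f (meanCurvatureVector I J f) p w := by
  have h1 : normalDerivative I J f (meanCurvatureVector I J f) p w = ∑ i, (inner ℝ w (b i) : ℝ) •
      normalDerivative I J f (meanCurvatureVector I J f) p (b i) := by
    rw [← normalDerivative_sum]
    congr 1
    rw [← b.sum_repr' w]
    simp only [real_inner_comm, b.sum_repr']
  rw [normalPart_sum]
  simp only [normalPart_curvature_of_umbilical hf humb, Finset.sum_sub_distrib, ← h1,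
    real_inner_self_eq_norm_sq, b.norm_eq_one]
  simp [sub_smul, Nat.cast_smul_eq_nsmul]

theorem IsSpecial.hasParallelMeanCurvature (hE : 2 ≤ Module.finrank ℝ E)
    (hf : IsIsometricImmersion I J f) (humb : IsUmbilical I J f) (h : IsSpecial I J f) :
    HasParallelMeanCurvature I J f := by
  have : Nontrivial E := Module.nontrivial_of_finrank_pos (R := ℝ) (by omega)
  intro p w
  have h1 := (normalPart_eq_zero_iff _).2 (h p (stdOrthonormalBasis ℝ (TangentSpace I p)) w)
  rw [normalPart_sum_curvature_of_umbilical hf humb, Fintype.card_fin] at h1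
  refine (smul_eq_zero.1 h1).resolve_left (sub_ne_zero.2 ?_)
  have h2 : (2 : ℝ) ≤ (Module.finrank ℝ (TangentSpace I p) : ℝ) := by exact_mod_cast hE
  intro h3
  linarith

end Equivalence

end SubmanifoldGeometry

end

theorem proposition3p4 {r m : ℕ} (hr : 2 ≤ r)
    {S : Type*} [TopologicalSpace S] [ChartedSpace (EuclideanSpace ℝ (Fin r)) S]
    [IsManifold (𝓡 r) ∞ S]
    [RiemannianBundle (fun p : S ↦ TangentSpace (𝓡 r) p)]
    [IsContMDiffRiemannianBundle (𝓡 r) ∞ (EuclideanSpace ℝ (Fin r))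
      (fun p : S ↦ TangentSpace (𝓡 r) p)]
    {M : Type*} [TopologicalSpace M] [ChartedSpace (EuclideanSpace ℝ (Fin m)) M]
    [IsManifold (𝓡 m) ∞ M]
    [RiemannianBundle (fun x : M ↦ TangentSpace (𝓡 m) x)]
    [IsContMDiffRiemannianBundle (𝓡 m) ∞ (EuclideanSpace ℝ (Fin m))
      (fun x : M ↦ TangentSpace (𝓡 m) x)]
    (f : S → M) (hf : SubmanifoldGeometry.IsIsometricImmersion (𝓡 r) (𝓡 m) f)
    (humb : SubmanifoldGeometry.IsUmbilical (𝓡 r) (𝓡 m) f) :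
    List.TFAE [SubmanifoldGeometry.IsSpecial (𝓡 r) (𝓡 m) f,
      SubmanifoldGeometry.IsVerySpecial (𝓡 r) (𝓡 m) f,
      SubmanifoldGeometry.IsExtrinsicSphere (𝓡 r) (𝓡 m) f] := by
  have hE : 2 ≤ Module.finrank ℝ (EuclideanSpace ℝ (Fin r)) := by simpa using hr
  have : Nontrivial (EuclideanSpace ℝ (Fin r)) :=
    Module.nontrivial_of_finrank_pos (R := ℝ) (by omega)
  tfae_have 2 → 1 := fun h ↦ h.isSpecial
  tfae_have 1 → 3 := fun h ↦ ⟨humb, h.hasParallelMeanCurvature hE hf humb⟩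
  tfae_have 3 → 2 := fun h ↦ h.2.isVerySpecial hf humb
  tfae_finish
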